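/- Let $\mathbb K$ be a normed division algebra over $\mathbb R$ and $\mathbb K'$ a split composition algebra over $\mathbb R$: finite-dimensional unital, not necessarily associative, real algebras $\neq 0$ with a nondegenerate quadratic form satisfying $|xy|^2=|x|^2|y|^2$, which is positive definite on $\mathbb K$, and on $\mathbb K'$ has $\kappa'_+$ plus and $\kappa'_-$ minus signs with $|\kappa'_+-\kappa'_-|\le 1$ (so $\mathbb K$ is one of $\mathbb R,\mathbb C,\mathbb H,\mathbb O$ and $\mathbb K'$ is $\mathbb R$ or one of the split forms $\mathbb C',\mathbb H',\mathbb O'$). Let $\kappa=\dim\mathbb K$, and let $\bar a$, $A^\star$ denote conjugation in $\mathbb K$ and $\mathbb K'$. Let $$V_2=\left\{X=\begin{pmatrix}A&\bar a\\ a&-A^\star\end{pmatrix}: A\in\mathbb K',\ a\in\mathbb K\right\},\qquad \Gamma(X)=\begin{pmatrix}0&X\\ \widetilde X&0\end{pmatrix},\quad \widetilde X=X-\operatorname{tr}(X)I,$$ be matrices over $\mathbb K'\otimes\mathbb K$, and let $V_4=\Gamma(V_2)$ carry the quadratic form $|\Gamma(X)|^2=-\det X$. For $P\in V_4$ let $P_L$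 be the linear map $M\mapsto PM$ on the space $M_4(\mathbb K'\otimes\mathbb K)$ of $4\times4$ matrices, and write $P\cdot Q=P_L\circ Q_L$. Let $C\ell(V_4)$ be the algebra generated by all $P_L$ under composition, $\mathrm{Pin}(V_4)$ the group of units of it generated by the $P_L$ with $P$ a unit vector ($|P|^2=\pm1$), and $\mathrm{Spin}(V_4)$ the subgroup generated by the products $P_1\cdot P_2$ of two unit vectors. Then $V_4$ has signature $(\kappa+\kappa'_+,\kappa'_-)$, and $C\ell(V_4)$ is, via $P\mapsto P_L$, the Clifford algebra of $V_4$, that is, $C\ell(\kappa+\kappa'_+,\kappa'_-)$. Every unit vector $P$ has a unique two-sided matrix inverse $P^{-1}=P/|P|^2$, one has $(PQ)P^{-1}=P(QP^{-1})$ for all $Q\in V_4$, $P_L\in\mathrm{Pin}(V_4)$, and every element of $\mathrm{Pin}(V_4)$ is a product of unit vectors. There is a surjective homomorphism $R:\mathrm{Pin}(V_4)\to O(V_4)$ that sends a unit vector $P$ to the reflection $R_P$ along $P$ (the linear map with $P\mapsto -P$ that fixes the orthogonal complement of $P$), given both by $(R_P(Q))_L=-P_L\circ Q_L\circ P_L^{-1}$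 and by the matrix product $R_P(Q)=-PQP^{-1}$, and that sends $g=P_1\cdot P_2\cdots P_n$, with unit vectors $P_i$, to $$R_g(Q)=(-1)^n P_1\bigl(P_2(\cdots(P_nQP_n^{-1})\cdots)P_2^{-1}\bigr)P_1^{-1}.$$ It restricts to a surjective homomorphism $\mathrm{Spin}(V_4)\to SO(V_4)$. Hence the second-order elements $P_1\cdot P_2$ ($P_1,P_2$ unit vectors) of $C\ell(\kappa+\kappa'_+,\kappa'_-)$ generate an action of $SO(\kappa+\kappa'_+,\kappa'_-)$ on $V_4$: for every isometry $e:\mathbb R^{\kappa+\kappa'_+,\kappa'_-}\to V_4$, the subgroup of $GL(V_4)$ generated by the maps $R_{P_1\cdot P_2}$ is the image of the faithful action of $SO(\kappa+\kappa'_+,\kappa'_-)$ on $V_4$ given by $h\cdot e(x)=e(hx)$. -/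

import Mathlib

open scoped TensorProduct

noncomputable section

namespace MagicSquare

/-- A (finite-dimensional) composition algebra over `ℝ`: a real, not necessarily associative,
algebra with unit `1 ≠ 0`, together with a nondegenerate multiplicative quadratic form, the
squared norm `nsq x = |x|²`.  Multiplication is `ℝ`-bilinear by the two parent classes
`IsScalarTower` and `SMulCommClass`. -/
class CompositionAlgebra (K : Type*) [NonAssocRing K] [Module ℝ K] extends
    IsScalarTower ℝ K K, SMulCommClass ℝ K K, Module.Finite ℝ K, Nontrivial K where
  nsq : QuadraticForm ℝ K
  nsq_nondegenerate : (QuadraticMap.polarBilin nsq).Nondegenerate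
  nsq_mul : ∀ x y : K, nsq (x * y) = nsq x * nsq y

section OneAlgebra

variable (K : Type*) [NonAssocRing K] [Module ℝ K] [CompositionAlgebra K]

/-- A normed division algebra is a composition algebra with positive definite norm form. -/
def IsNormedDivision : Prop :=
  (CompositionAlgebra.nsq : QuadraticForm ℝ K).PosDef

/-- The number of positive-normed elements of an orthogonal basis. -/
def kappaPos : ℕ := sigPos (CompositionAlgebra.nsq : QuadraticForm ℝ K)

/-- The number of negative-normed elements of an orthogonal basis. -/
def kappaNeg : ℕ := sigNeg (CompositionAlgebra.nsq : QuadraticForm ℝ K)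

/-- A composition algebra is split if the signature of its norm form is as close to zero as
possible: `0` in even dimensions, `±1` in odd dimensions. -/
def IsSplit : Prop :=
  |(kappaPos K : ℤ) - (kappaNeg K : ℤ)| ≤ 1

variable {K}

/-- The real part `Re x = (x, 1)`, where `(x, y)` is the inner product polarizing `|x|²`. -/
def reL : K →ₗ[ℝ] ℝ :=
  (1 / 2 : ℝ) • (QuadraticMap.polarBilin (CompositionAlgebra.nsq : QuadraticForm ℝ K)) 1

/-- Conjugation: it fixes `1` and is `-1` on the orthogonal complement of `1`. -/
def conjL : K →ₗ[ℝ] K :=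
  (2 : ℝ) • (reL (K := K)).smulRight 1 - LinearMap.id

end OneAlgebra

section OrthogonalGroups

variable {M : Type*} [AddCommGroup M] [Module ℝ M]

/-- The orthogonal group `O(M, Q)`. -/
def orthogonalGrp (Q : QuadraticForm ℝ M) : Subgroup (M ≃ₗ[ℝ] M) where
  carrier := {f | ∀ x, Q (f x) = Q x}
  mul_mem' := by
    intro f g hf hg x
    rw [LinearEquiv.mul_apply, hf, hg]
  one_mem' := fun _ => rfl
  inv_mem' := by
    intro f hf x
    rw [← hf (f⁻¹ x), ← LinearEquiv.mul_apply, mul_inv_cancel, LinearEquiv.coe_one, id]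

/-- The special orthogonal group `SO(M, Q)`. -/
def specialOrthogonalGrp (Q : QuadraticForm ℝ M) : Subgroup (M ≃ₗ[ℝ] M) :=
  orthogonalGrp Q ⊓ (LinearEquiv.det (R := ℝ) (M := M)).ker

/-- The standard quadratic form of signature `(p, q)` on `ℝ^(p+q)`: `p` plus signs, `q` minus
signs. -/
def stdForm (p q : ℕ) : QuadraticForm ℝ (Fin p ⊕ Fin q → ℝ) :=
  QuadraticMap.weightedSumSquares ℝ (Sum.elim (fun _ => (1 : ℝ)) (fun _ => (-1 : ℝ)))

end OrthogonalGroups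

section TwoAlgebras

variable (K' K : Type*) [NonAssocRing K'] [Module ℝ K'] [CompositionAlgebra K']
  [NonAssocRing K] [Module ℝ K] [CompositionAlgebra K]

/-- `2 × 2` matrices over `K' ⊗ K`. -/
abbrev Mat2 := Matrix (Fin 2) (Fin 2) (K' ⊗[ℝ] K)

/-- `4 × 4` matrices over `K' ⊗ K`, written in `2 × 2` blocks.  The product is the usual matrix
product; it is not associative in general. -/
abbrev Mat4 := Matrix (Fin 2 ⊕ Fin 2) (Fin 2 ⊕ Fin 2) (K' ⊗[ℝ] K)

/-- The space `V₂` of the matrices `(A, ā; a, -A*)`, with `a ∈ K` and `A ∈ K'`. -/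
def V2 : Submodule ℝ (Mat2 K' K) where
  carrier := {X | ∃ (A : K') (a : K),
    X = !![A ⊗ₜ[ℝ] (1 : K), (1 : K') ⊗ₜ[ℝ] conjL a;
           (1 : K') ⊗ₜ[ℝ] a, -(conjL A ⊗ₜ[ℝ] (1 : K))]}
  add_mem' := by
    rintro _ _ ⟨A, a, rfl⟩ ⟨B, b, rfl⟩
    refine ⟨A + B, a + b, ?_⟩
    ext i j
    fin_cases i <;> fin_cases j <;>
      simp [TensorProduct.add_tmul, TensorProduct.tmul_add, add_comm]
  zero_mem' := by
    refine ⟨0, 0, ?_⟩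
    ext i j
    fin_cases i <;> fin_cases j <;> simp
  smul_mem' := by
    rintro c _ ⟨A, a, rfl⟩
    refine ⟨c • A, c • a, ?_⟩
    ext i j
    fin_cases i <;> fin_cases j <;>
      simp [TensorProduct.smul_tmul']

/-- Trace reversal `X ↦ X - tr(X) I`. -/
def traceReversal : Mat2 K' K →ₗ[ℝ] Mat2 K' K where
  toFun X := X - Matrix.diagonal (fun _ => X.trace)
  map_add' X Y := by
    ext i j
    by_cases h : i = j
    · subst h; simp; abel
    · simp [h]
  map_smul' c X := by
    ext i j
    by_cases h : i = j
    · subst h; simp [smul_sub]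
    · simp [h]

/-- `Γ(X) = (0, X; X̃, 0)`, where `X̃` is the trace reversal of `X`. -/
def Gam : Mat2 K' K →ₗ[ℝ] Mat4 K' K where
  toFun X := Matrix.fromBlocks 0 X (traceReversal K' K X) 0
  map_add' X Y := by
    rw [map_add, Matrix.fromBlocks_add, add_zero]
  map_smul' c X := by
    rw [map_smul, RingHom.id_apply, Matrix.fromBlocks_smul, smul_zero]

/-- The space `V₄ = Γ(V₂)` of `4 × 4` matrices. -/
def V4 : Submodule ℝ (Mat4 K' K) := (V2 K' K).map (Gam K' K)

/-- The real part on `K' ⊗ K`, with `Re (A ⊗ a) = Re A · Re a`. -/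
def reTensor : K' ⊗[ℝ] K →ₗ[ℝ] ℝ :=
  LinearMap.mul' ℝ ℝ ∘ₗ TensorProduct.map reL reL

/-- The quadratic form `X ↦ -det X`, where `det X = X₀₀ X₁₁ - X₀₁ X₁₀`.  On `V₂` the determinant
is a real multiple of `1 ∈ K' ⊗ K`; its real part is that real number. -/
def negDet : QuadraticForm ℝ (Mat2 K' K) :=
  LinearMap.BilinMap.toQuadraticMap
    ((((LinearMap.mul ℝ (K' ⊗[ℝ] K)).compl₁₂
        (Matrix.entryLinearMap ℝ (K' ⊗[ℝ] K) (0 : Fin 2) (1 : Fin 2))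
        (Matrix.entryLinearMap ℝ (K' ⊗[ℝ] K) (1 : Fin 2) (0 : Fin 2)))
      - ((LinearMap.mul ℝ (K' ⊗[ℝ] K)).compl₁₂
        (Matrix.entryLinearMap ℝ (K' ⊗[ℝ] K) (0 : Fin 2) (0 : Fin 2))
        (Matrix.entryLinearMap ℝ (K' ⊗[ℝ] K) (1 : Fin 2) (1 : Fin 2)))).compr₂ (reTensor K' K))

/-- The linear map that takes a `4 × 4` matrix to its upper right `2 × 2` block,
thus `Γ(X)` to `X`. -/
def upperRight : Mat4 K' K →ₗ[ℝ] Mat2 K' K where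
  toFun P := P.toBlocks₁₂
  map_add' _ _ := rfl
  map_smul' _ _ := rfl

/-- The quadratic form of `V₄`: `|Γ(X)|² = g(Γ(X), Γ(X)) = -det X`. -/
def V4form : QuadraticForm ℝ (V4 K' K) :=
  (negDet K' K).comp ((upperRight K' K) ∘ₗ (V4 K' K).subtype)

/-- The subalgebra of `End (Mat4)` (with composition as product) generated by the left
multiplications `P_L : Q ↦ P Q` by the elements `P` of `V₄`. -/
def Cl : Subalgebra ℝ (Module.End ℝ (Mat4 K' K)) :=
  Algebra.adjoin ℝ {T | ∃ P ∈ V4 K' K, T = LinearMap.mulLeft ℝ P}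

variable {K' K}

/-- A unit vector of `V₄`: `|P|² = ±1`. -/
def IsUnitVec (P : V4 K' K) : Prop :=
  V4form K' K P = 1 ∨ V4form K' K P = -1

/-- The matrix `P⁻¹ = P / |P|²`, for `P ∈ V₄` with `|P|² ≠ 0`. -/
def vinv (P : V4 K' K) : Mat4 K' K := (V4form K' K P)⁻¹ • (P : Mat4 K' K)

/-- `P ↦ P_L`, the identification of the vectors of `V₄` with elements of the Clifford
algebra. -/
def toCl (P : V4 K' K) : Cl K' K :=
  ⟨LinearMap.mulLeft ℝ (P : Mat4 K' K), Algebra.subset_adjoin ⟨P, P.2, rfl⟩⟩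

variable (K' K)

/-- `Pin(V₄)`: the group generated by the unit vectors in the Clifford algebra. -/
def Pin : Subgroup (Cl K' K)ˣ :=
  Subgroup.closure {u | ∃ P : V4 K' K, IsUnitVec P ∧ (u : Cl K' K) = toCl P}

/-- `Spin(V₄)`: the subgroup of `Pin(V₄)` generated by the products of pairs of unit vectors. -/
def Spin : Subgroup (Pin K' K) :=
  Subgroup.closure {g | ∃ P₁ P₂ : V4 K' K, IsUnitVec P₁ ∧ IsUnitVec P₂ ∧
    ((g : (Cl K' K)ˣ) : Cl K' K) = toCl P₁ * toCl P₂}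

variable {K' K}

/-- The nested matrix product `P₁(P₂(⋯(Pₙ Q Pₙ⁻¹)⋯)P₂⁻¹)P₁⁻¹`. -/
def nestedConj : List (V4 K' K) → Mat4 K' K → Mat4 K' K
  | [], Q => Q
  | P :: l, Q => ((P : Mat4 K' K) * nestedConj l Q) * vinv P

end TwoAlgebras

end MagicSquare

end

open MagicSquare

open MagicSquare

/-!
# The spin group of `V₄` acting by matrix products over `K' ⊗ K`

In a composition algebra the norm form satisfies `x̄ (x y) = |x|² y = (y x̄) x`, which follows from
multiplicativity by polarizing twice and using that the form is nondegenerate.  The entries of a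
matrix `P` in `V₄` are elements of `K'` and of `K`, and left multiplications by `A ⊗ 1` and `1 ⊗ a`
commute; so these identities give `P (P M) = |P|² M = (M P) P` for all matrices `M`
(`V4_mul_mul`, `mul_mul_V4`), although the matrix product is not associative.

The first identity is the Clifford relation for `P ↦ P_L`, so there is a surjective homomorphism
from the Clifford algebra of `V₄` to `Cl`.  It is injective because the matrices of `V₄` are odd for
the grading by blocks, so that its kernel is stable under the grade involution, and the Clifford
algebra of a nondegenerate form has no proper ideals with that property (`injective_of_involute`).
For odd dimension this argument cannot do without the grading, as the Clifford algebra need not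
be simple.  Together, the two identities determine `P (Q P)` and `(P Q) P` as the same combination
of `P` and `Q`, so that the reflection along `P` is `Q ↦ - P Q P⁻¹`, with any bracketing
(`mul_mul_self_assoc`, `coe_orthoReflection`).

With the grade involution `s` of `Cl`, the map `R` is the twisted adjoint representation, determined
by `(R_g Q)_L = s(g) Q_L g⁻¹`.  It takes a unit vector to the reflection along it.  Reflections
generate the orthogonal group of a nondegenerate form, also of an indefinite one
(`closure_unitReflections`); and reflections have determinant `-1`, so that the products of an even
number of them are the elements of the special orthogonal group.

The form of `V₄` is the orthogonal sum of the two norm forms (`isometryV4`), which gives the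
signature.
-/

/-! ### Reflections generate the orthogonal group -/

section Reflections

variable {M : Type*} [AddCommGroup M] [Module ℝ M]

/-- The reflection `y ↦ y - (2 (v, y) / |v|²) v` along a vector `v` with `Q v ≠ 0`, where the inner
product `(v, y)` is half of the polar form of `Q`. -/
noncomputable def orthoReflection (Q : QuadraticForm ℝ M) (v : M) (hv : Q v ≠ 0) : M ≃ₗ[ℝ] M :=
  Module.reflection (x := v) (f := (Q v)⁻¹ • QuadraticMap.polarBilin Q v) (by
    simp only [LinearMap.smul_apply, QuadraticMap.polarBilin_apply_apply, QuadraticMap.polar_self,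
      smul_eq_mul, nsmul_eq_mul]
    field_simp
    norm_num)

theorem orthoReflection_apply (Q : QuadraticForm ℝ M) (v : M) (hv : Q v ≠ 0) (y : M) :
    orthoReflection Q v hv y = y - ((Q v)⁻¹ * QuadraticMap.polar Q v y) • v := by
  simp [orthoReflection, Module.reflection_apply]

theorem orthoReflection_self (Q : QuadraticForm ℝ M) (v : M) (hv : Q v ≠ 0) :
    orthoReflection Q v hv v = -v :=
  Module.reflection_apply_self _

theorem orthoReflection_of_polar_eq_zero (Q : QuadraticForm ℝ M) (v : M) (hv : Q v ≠ 0) {y : M}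
    (hy : QuadraticMap.polar Q v y = 0) : orthoReflection Q v hv y = y := by
  simp [orthoReflection_apply, hy]

theorem quadraticForm_sub_smul (Q : QuadraticForm ℝ M) (y v : M) (c : ℝ) :
    Q (y - c • v) = Q y - c * QuadraticMap.polar Q v y + c ^ 2 * Q v := by
  have h : Q (y + (-c) • v) = _ := QuadraticMap.map_add Q y ((-c) • v)
  rw [QuadraticMap.polar_smul_right, QuadraticMap.map_smul, QuadraticMap.polar_comm] at h
  rw [sub_eq_add_neg, ← neg_smul, h]
  simp only [smul_eq_mul]
  ring

theorem orthoReflection_mem (Q : QuadraticForm ℝ M) (v : M) (hv : Q v ≠ 0) :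
    orthoReflection Q v hv ∈ orthogonalGrp Q := by
  intro y
  rw [orthoReflection_apply, quadraticForm_sub_smul]
  field_simp
  ring

theorem det_orthoReflection [Module.Finite ℝ M] (Q : QuadraticForm ℝ M) (v : M) (hv : Q v ≠ 0) :
    LinearEquiv.det (orthoReflection Q v hv) = -1 := by
  have h : (orthoReflection Q v hv : M →ₗ[ℝ] M) =
      LinearMap.transvection (-((Q v)⁻¹ • QuadraticMap.polarBilin Q v)) v := by
    ext y
    simp [orthoReflection_apply, LinearMap.transvection.apply, sub_eq_add_neg]
  rw [← Units.val_inj, LinearEquiv.coe_det, h, LinearMap.transvection.det]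
  simp only [LinearMap.neg_apply, LinearMap.smul_apply, QuadraticMap.polarBilin_apply_apply,
    QuadraticMap.polar_self, smul_eq_mul, nsmul_eq_mul, Units.val_neg, Units.val_one]
  field_simp
  norm_num

/-- The reflections along the vectors of square norm `±1`. -/
def unitReflections (Q : QuadraticForm ℝ M) : Set (M ≃ₗ[ℝ] M) :=
  {f | ∃ (v : M) (hv : Q v ≠ 0), (Q v = 1 ∨ Q v = -1) ∧ f = orthoReflection Q v hv}

theorem orthoReflection_mem_unitReflections (Q : QuadraticForm ℝ M) (v : M) (hv : Q v ≠ 0) :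
    orthoReflection Q v hv ∈ unitReflections Q := by
  have hpos : 0 < |Q v| := abs_pos.mpr hv
  set c : ℝ := (√|Q v|)⁻¹ with hc
  have hc0 : c ≠ 0 := inv_ne_zero (Real.sqrt_ne_zero'.mpr hpos)
  have hcc : c * c = |Q v|⁻¹ := by
    rw [hc, ← mul_inv, Real.mul_self_sqrt hpos.le]
  have hQ : Q (c • v) = |Q v|⁻¹ * Q v := by rw [QuadraticMap.map_smul, hcc, smul_eq_mul]
  refine ⟨c • v, ?_, ?_, ?_⟩
  · rw [hQ]
    exact mul_ne_zero (inv_ne_zero hpos.ne') hv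
  · rw [hQ]
    rcases abs_choice (Q v) with h | h
    · left
      rw [h, inv_mul_cancel₀ hv]
    · right
      rw [h, inv_neg, neg_mul, inv_mul_cancel₀ hv]
  · ext y
    rw [orthoReflection_apply, orthoReflection_apply, QuadraticMap.map_smul,
      QuadraticMap.polar_smul_left, smul_smul]
    congr 2
    simp only [smul_eq_mul]
    field_simp

/-- Two vectors with the same square norm `≠ 0` are exchanged by a product of one or two
reflections.  This holds as `|v - w|² + |v + w|² = 4 |v|² ≠ 0`, so that there is a reflection
along `v - w`, taking `w` to `v`, or one along `v + w`, taking `w` to `-v`. -/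
theorem exists_mem_closure_unitReflections_map (Q : QuadraticForm ℝ M) {v w : M} (hv : Q v ≠ 0)
    (hvw : Q w = Q v) :
    ∃ h ∈ Subgroup.closure (unitReflections Q), h w = v ∧
      ∀ x, QuadraticMap.polar Q v x = 0 → QuadraticMap.polar Q w x = 0 → h x = x := by
  have hadd : Q (w + v) = 2 * Q v + QuadraticMap.polar Q w v := by
    rw [QuadraticMap.map_add Q w v, hvw]; ring
  have hsub : Q (w - v) = 2 * Q v - QuadraticMap.polar Q w v := by
    rw [sub_eq_add_neg, QuadraticMap.map_add Q w (-v), QuadraticMap.polar_neg_right,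
      QuadraticMap.map_neg, hvw]
    ring
  by_cases h0 : Q (w - v) = 0
  · have h1 : Q (w + v) ≠ 0 := by
      intro h1
      apply hv
      linarith
    refine ⟨orthoReflection Q v hv * orthoReflection Q (w + v) h1,
      mul_mem (Subgroup.subset_closure (orthoReflection_mem_unitReflections Q v hv))
        (Subgroup.subset_closure (orthoReflection_mem_unitReflections Q (w + v) h1)), ?_, ?_⟩
    · have : orthoReflection Q (w + v) h1 w = -v := by
        rw [orthoReflection_apply, QuadraticMap.polar_add_left, QuadraticMap.polar_self,
          QuadraticMap.polar_comm Q v w]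
        have : (Q (w + v))⁻¹ * (2 • Q w + QuadraticMap.polar Q w v) = 1 := by
          rw [inv_mul_eq_one₀ h1, hadd, hvw]
          simp
        rw [this, one_smul]
        abel
      rw [LinearEquiv.mul_apply, this, map_neg, orthoReflection_self, neg_neg]
    · intro x hx hx'
      rw [LinearEquiv.mul_apply, orthoReflection_of_polar_eq_zero Q (w + v) h1,
        orthoReflection_of_polar_eq_zero Q v hv hx]
      rw [QuadraticMap.polar_add_left, hx, hx', add_zero]
  · refine ⟨orthoReflection Q (w - v) h0,
      Subgroup.subset_closure (orthoReflection_mem_unitReflections Q (w - v) h0), ?_, ?_⟩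
    · rw [orthoReflection_apply, QuadraticMap.polar_sub_left, QuadraticMap.polar_self,
        QuadraticMap.polar_comm Q v w]
      have : (Q (w - v))⁻¹ * (2 • Q w - QuadraticMap.polar Q w v) = 1 := by
        rw [inv_mul_eq_one₀ h0, hsub, hvw]
        simp
      rw [this, one_smul]
      abel
    · intro x hx hx'
      rw [orthoReflection_of_polar_eq_zero Q (w - v) h0]
      rw [QuadraticMap.polar_sub_left, hx, hx', sub_zero]

theorem polar_map_of_mem_orthogonalGrp {Q : QuadraticForm ℝ M} {f : M ≃ₗ[ℝ] M}
    (hf : f ∈ orthogonalGrp Q) (x y : M) :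
    QuadraticMap.polar Q (f x) (f y) = QuadraticMap.polar Q x y := by
  rw [QuadraticMap.polar, QuadraticMap.polar, ← map_add, hf, hf, hf]

theorem closure_unitReflections_le (Q : QuadraticForm ℝ M) :
    Subgroup.closure (unitReflections Q) ≤ orthogonalGrp Q := by
  rw [Subgroup.closure_le]
  rintro _ ⟨v, hv, -, rfl⟩
  exact orthoReflection_mem Q v hv

/-- The weak form of the Cartan–Dieudonné theorem, for a form with a diagonalizing basis of
anisotropic vectors: the vectors of the basis are brought back one by one by reflections
that fix the previous ones. -/
theorem closure_unitReflections (Q : QuadraticForm ℝ M) {ι : Type*} [Finite ι]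
    (b : Module.Basis ι ℝ M) (hb : ∀ i, Q (b i) ≠ 0)
    (hbb : Pairwise fun i j => QuadraticMap.polar Q (b i) (b j) = 0) :
    Subgroup.closure (unitReflections Q) = orthogonalGrp Q := by
  classical
  have := Fintype.ofFinite ι
  refine le_antisymm (closure_unitReflections_le Q) fun f hf => ?_
  have key : ∀ s : Finset ι, ∃ h ∈ Subgroup.closure (unitReflections Q),
      ∀ i ∈ s, (h * f) (b i) = b i := by
    intro s
    induction s using Finset.induction_on with
    | empty => exact ⟨1, one_mem _, by simp⟩
    | insert k s hk ih =>
      obtain ⟨h, hh, hs⟩ := ih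
      have hhf : h * f ∈ orthogonalGrp Q := mul_mem (closure_unitReflections_le Q hh) hf
      obtain ⟨g, hg, hgk, hgx⟩ := exists_mem_closure_unitReflections_map Q (hb k) (hhf (b k))
      refine ⟨g * h, mul_mem hg hh, fun i hi => ?_⟩
      rw [mul_assoc, LinearEquiv.mul_apply]
      rcases Finset.mem_insert.mp hi with rfl | hi
      · exact hgk
      · have hki : k ≠ i := by
          rintro rfl
          exact hk hi
        rw [hs i hi]
        refine hgx _ (hbb hki) ?_
        rw [← hs i hi]
        rw [polar_map_of_mem_orthogonalGrp hhf]
        exact hbb hki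
  obtain ⟨h, hh, hs⟩ := key Finset.univ
  have h1 : h * f = 1 := by
    apply LinearEquiv.toLinearMap_injective
    exact b.ext fun i => hs i (Finset.mem_univ i)
  rw [eq_inv_of_mul_eq_one_right h1]
  exact inv_mem hh

end Reflections

/-! ### Homomorphisms from a Clifford algebra that respect the grading -/

section Clifford

open CliffordAlgebra

variable {M : Type*} [AddCommGroup M] [Module ℝ M] {Q : QuadraticForm ℝ M}

theorem involute_mem_adjoin_image_ι {t : Set M} {x : CliffordAlgebra Q}
    (hx : x ∈ Algebra.adjoin ℝ (ι Q '' t)) : involute x ∈ Algebra.adjoin ℝ (ι Q '' t) := by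
  induction hx using Algebra.adjoin_induction with
  | mem x hx =>
    obtain ⟨m, hm, rfl⟩ := hx
    rw [involute_ι]
    exact neg_mem (Algebra.subset_adjoin ⟨m, hm, rfl⟩)
  | algebraMap r => rw [AlgHom.commutes]; exact algebraMap_mem _ r
  | add x y _ _ hx hy => rw [map_add]; exact add_mem hx hy
  | mul x y _ _ hx hy => rw [map_mul]; exact mul_mem hx hy

/-- A vector orthogonal to `t` graded-commutes with the subalgebra generated by `t`. -/
theorem ι_mul_eq_involute_mul_ι {t : Set M} {v : M}
    (hv : ∀ m ∈ t, QuadraticMap.polar Q v m = 0) {x : CliffordAlgebra Q}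
    (hx : x ∈ Algebra.adjoin ℝ (ι Q '' t)) : ι Q v * x = involute x * ι Q v := by
  induction hx using Algebra.adjoin_induction with
  | mem x hx =>
    obtain ⟨m, hm, rfl⟩ := hx
    rw [involute_ι, ι_mul_ι_comm, hv m hm, map_zero, zero_sub, neg_mul]
  | algebraMap r => rw [AlgHom.commutes]; exact (Algebra.commutes r _).symm
  | add x y _ _ hx hy => rw [map_add, mul_add, add_mul, hx, hy]
  | mul x y _ _ hx hy => rw [map_mul, ← mul_assoc, hx, mul_assoc, hy, mul_assoc]

theorem exists_add_ι_mul_of_mem_adjoin_insert {t : Set M} {v : M}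
    (hv : ∀ m ∈ t, QuadraticMap.polar Q v m = 0) {x : CliffordAlgebra Q}
    (hx : x ∈ Algebra.adjoin ℝ (ι Q '' insert v t)) :
    ∃ a ∈ Algebra.adjoin ℝ (ι Q '' t), ∃ c ∈ Algebra.adjoin ℝ (ι Q '' t), x = a + ι Q v * c := by
  induction hx using Algebra.adjoin_induction with
  | mem x hx =>
    obtain ⟨m, rfl | hm, rfl⟩ := hx
    · exact ⟨0, zero_mem _, 1, one_mem _, by simp⟩
    · exact ⟨_, Algebra.subset_adjoin ⟨m, hm, rfl⟩, 0, zero_mem _, by simp⟩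
  | algebraMap r => exact ⟨_, algebraMap_mem _ r, 0, zero_mem _, by simp⟩
  | add x y _ _ hx hy =>
    obtain ⟨a, ha, c, hc, rfl⟩ := hx
    obtain ⟨a', ha', c', hc', rfl⟩ := hy
    exact ⟨a + a', add_mem ha ha', c + c', add_mem hc hc', by rw [mul_add]; abel⟩
  | mul x y _ _ hx hy =>
    obtain ⟨a, ha, c, hc, rfl⟩ := hx
    obtain ⟨a', ha', c', hc', rfl⟩ := hy
    refine ⟨a * a' + algebraMap ℝ _ (Q v) * (involute c * c'),
      add_mem (mul_mem ha ha') (mul_mem (algebraMap_mem _ _)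
        (mul_mem (involute_mem_adjoin_image_ι hc) hc')),
      involute a * c' + c * a',
      add_mem (mul_mem (involute_mem_adjoin_image_ι ha) hc') (mul_mem hc ha'), ?_⟩
    have h1 : a * (ι Q v * c') = ι Q v * (involute a * c') := by
      rw [← mul_assoc, ← mul_assoc, ι_mul_eq_involute_mul_ι hv (involute_mem_adjoin_image_ι ha),
        involute_involute]
    have h2 : ι Q v * c * (ι Q v * c') = algebraMap ℝ _ (Q v) * (involute c * c') := by
      rw [← mul_assoc, ← mul_assoc, ι_mul_eq_involute_mul_ι hv hc, mul_assoc (involute c),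
        ι_sq_scalar, ← Algebra.commutes (Q v) (involute c), mul_assoc]
    rw [add_mul, mul_add, mul_add, h1, h2, mul_add, mul_assoc]
    abel

/-- A Clifford algebra of a nondegenerate form has no proper ideals that are stable under the
grade involution: with an orthogonal basis `b`, an element `a + b k * c`, where `a` and `c` do not
involve `b k`, is separated into its two terms by `x ↦ b k * involute x * b k`. -/
theorem injective_of_involute {ι' : Type*} [Finite ι'] (b : Module.Basis ι' ℝ M)
    (hb : ∀ i, Q (b i) ≠ 0)
    (hbb : Pairwise fun i j => QuadraticMap.polar Q (b i) (b j) = 0)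
    {A : Type*} [Ring A] [Algebra ℝ A] [Nontrivial A] (f : CliffordAlgebra Q →ₐ[ℝ] A)
    (hf : ∀ x, f x = 0 → f (involute x) = 0) : Function.Injective f := by
  classical
  have := Fintype.ofFinite ι'
  have key : ∀ s : Finset ι', ∀ x ∈ Algebra.adjoin ℝ (ι Q '' (b '' s)), f x = 0 → x = 0 := by
    intro s
    induction s using Finset.induction_on with
    | empty =>
      intro x hx hfx
      simp only [Finset.coe_empty, Set.image_empty, Algebra.adjoin_empty] at hx
      obtain ⟨r, rfl⟩ := Algebra.mem_bot.mp hx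
      rw [AlgHom.commutes] at hfx
      rw [(map_eq_zero_iff _ (algebraMap ℝ A).injective).mp hfx, map_zero]
    | insert k s hk ih =>
      intro x hx hfx
      rw [Finset.coe_insert, Set.image_insert_eq] at hx
      have hv : ∀ m ∈ b '' s, QuadraticMap.polar Q (b k) m = 0 := by
        rintro _ ⟨i, hi, rfl⟩
        apply hbb
        rintro rfl
        exact hk hi
      obtain ⟨a, ha, c, hc, rfl⟩ := exists_add_ι_mul_of_mem_adjoin_insert hv hx
      have h1 : ι Q (b k) * involute (a + ι Q (b k) * c) * ι Q (b k) =
          Q (b k) • (a - ι Q (b k) * c) := by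
        have e1 := ι_mul_eq_involute_mul_ι hv (involute_mem_adjoin_image_ι ha)
        have e2 := ι_mul_eq_involute_mul_ι hv hc
        rw [involute_involute] at e1
        rw [map_add, map_mul, involute_ι, mul_add, add_mul, e1, mul_assoc a, ι_sq_scalar,
          neg_mul, mul_neg, neg_mul, ← mul_assoc, ι_sq_scalar, mul_assoc, ← e2,
          ← Algebra.commutes, ← Algebra.smul_def, ← Algebra.smul_def, smul_sub, sub_eq_add_neg]
      have h2 : f (a - ι Q (b k) * c) = 0 := by
        have := congrArg f h1
        rw [map_mul, map_mul, hf _ hfx, mul_zero, zero_mul, map_smul] at this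
        exact (smul_eq_zero.mp this.symm).resolve_left (hb k)
      rw [map_add] at hfx
      rw [map_sub] at h2
      have h3 : (2 : ℝ) • f a = 0 := by
        rw [two_smul]
        nth_rewrite 2 [sub_eq_zero.mp h2]
        exact hfx
      have ha0 : f a = 0 := (smul_eq_zero.mp h3).resolve_left two_ne_zero
      have hc0 : f c = 0 := by
        have h4 : f (ι Q (b k) * c) = 0 := by rwa [ha0, zero_add] at hfx
        have h5 : Q (b k) • f c = 0 := by
          rw [← map_smul, Algebra.smul_def, ← ι_sq_scalar, mul_assoc, map_mul, h4, mul_zero]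
        exact (smul_eq_zero.mp h5).resolve_left (hb k)
      rw [ih a ha ha0, ih c hc hc0, mul_zero, add_zero]
  rw [injective_iff_map_eq_zero]
  intro x hfx
  refine key Finset.univ x ?_ hfx
  have htop : Algebra.adjoin ℝ (ι Q '' (b '' (Finset.univ : Finset ι'))) = ⊤ := by
    rw [eq_top_iff, ← adjoin_range_ι, Algebra.adjoin_le_iff]
    rintro _ ⟨m, rfl⟩
    rw [← b.sum_repr m, map_sum]
    refine sum_mem fun i _ => ?_
    rw [map_smul]
    exact Subalgebra.smul_mem _ (Algebra.subset_adjoin (Set.mem_image_of_mem _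
      (Set.mem_image_of_mem _ (Finset.mem_coe.mpr (Finset.mem_univ i))))) _
  rw [htop]
  trivial

end Clifford

/-! ### The groups generated by unit vectors in an algebra, and their twisted action -/

section TwistedConjugation

variable {V A : Type*} [AddCommGroup V] [Module ℝ V] [Semiring A] [Algebra ℝ A]

/-- For a linear map `j` from a quadratic space to an algebra: the group of units generated by the
images of the vectors of square norm `±1`.  Here and below the algebra is only assumed to be a
semiring, so that for `Cl` the group is `Pin` by definition, without a passage between the
semiring structure of `Cl` and the one underlying its ring structure. -/
def pinOf (Q : QuadraticForm ℝ V) (j : V →ₗ[ℝ] A) : Subgroup Aˣ :=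
  Subgroup.closure {u | ∃ v, (Q v = 1 ∨ Q v = -1) ∧ (u : A) = j v}

/-- The subgroup of `pinOf Q j` generated by the products of two unit vectors. -/
def spinOf (Q : QuadraticForm ℝ V) (j : V →ₗ[ℝ] A) : Subgroup (pinOf Q j) :=
  Subgroup.closure {g | ∃ v w, (Q v = 1 ∨ Q v = -1) ∧ (Q w = 1 ∨ Q w = -1) ∧
    ((g : Aˣ) : A) = j v * j w}

variable {Q : QuadraticForm ℝ V} {j : V →ₗ[ℝ] A}

theorem ne_zero_of_eq_one_or {r : ℝ} (h : r = 1 ∨ r = -1) : r ≠ 0 := by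
  rcases h with rfl | rfl <;> norm_num

/-- The inverse of a unit `j v` is `j v / Q v`. -/
theorem units_inv_eq_of_mul_self (hj : ∀ v, j v * j v = algebraMap ℝ A (Q v)) {v : V}
    (hv : Q v ≠ 0) {u : Aˣ} (hu : (u : A) = j v) : ((u⁻¹ : Aˣ) : A) = (Q v)⁻¹ • j v := by
  rw [Units.inv_eq_of_mul_eq_one_right]
  rw [hu, mul_smul_comm, hj, Algebra.smul_def, ← map_mul, inv_mul_cancel₀ hv, map_one]

/-- The Clifford relation `j v * j y + j y * j v = 2 (v, y)`, multiplied by the inverse of `j v`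
from the right. -/
theorem mul_mul_inv_eq_neg_orthoReflection (hj : ∀ v, j v * j v = algebraMap ℝ A (Q v)) {v : V}
    (hv : Q v ≠ 0) {u : Aˣ} (hu : (u : A) = j v) (y : V) :
    j v * j y * ((u⁻¹ : Aˣ) : A) = j (-orthoReflection Q v hv y) := by
  have h1 : j v * j y + j y * j v = algebraMap ℝ A (QuadraticMap.polar Q v y) := by
    -- An algebra over `ℝ` has negatives, even if it is given as a semiring.
    let _ : Ring A := Algebra.semiringToRing ℝ
    exact CliffordAlgebra.mul_add_swap_eq_polar_of_forall_mul_self_eq j hj v y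
  have h2 : j v * ((u⁻¹ : Aˣ) : A) = 1 := by rw [← hu, Units.mul_inv]
  have h3 := congrArg (· * ((u⁻¹ : Aˣ) : A)) h1
  simp only [add_mul] at h3
  rw [mul_assoc (j y), h2, mul_one, units_inv_eq_of_mul_self hj hv hu, ← Algebra.smul_def,
    smul_smul, ← units_inv_eq_of_mul_self hj hv hu, ← map_smul] at h3
  have h4 := congrArg (· + j (-y)) h3
  simp only [add_assoc, ← map_add, add_neg_cancel, map_zero, add_zero] at h4
  rw [h4, orthoReflection_apply, neg_sub, sub_eq_add_neg, mul_comm]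

theorem neg_mul_mul_inv_eq_orthoReflection (hj : ∀ v, j v * j v = algebraMap ℝ A (Q v)) {v : V}
    (hv : Q v ≠ 0) {u : Aˣ} (hu : (u : A) = j v) (y : V) :
    j (-v) * j y * ((u⁻¹ : Aˣ) : A) = j (orthoReflection Q v hv y) := by
  rw [← neg_one_smul ℝ v, map_smul, smul_mul_assoc, smul_mul_assoc,
    mul_mul_inv_eq_neg_orthoReflection hj hv hu, ← map_smul, neg_one_smul, neg_neg]

theorem exists_unit_eq (hj : ∀ v, j v * j v = algebraMap ℝ A (Q v)) {v : V}
    (hv : Q v = 1 ∨ Q v = -1) : ∃ g : pinOf Q j, ((g : Aˣ) : A) = j v := by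
  have h0 := ne_zero_of_eq_one_or hv
  have h1 : algebraMap ℝ A (Q v)⁻¹ * algebraMap ℝ A (Q v) = 1 := by
    rw [← map_mul, inv_mul_cancel₀ h0, map_one]
  let u : Aˣ := ⟨j v, (Q v)⁻¹ • j v, by rw [mul_smul_comm, hj, Algebra.smul_def, h1],
    by rw [smul_mul_assoc, hj, Algebra.smul_def, h1]⟩
  exact ⟨⟨u, Subgroup.subset_closure ⟨v, hv, rfl⟩⟩, rfl⟩

theorem exists_list_of_pinOf (hj : ∀ v, j v * j v = algebraMap ℝ A (Q v)) (g : pinOf Q j) :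
    ∃ l : List V, (∀ v ∈ l, Q v = 1 ∨ Q v = -1) ∧ ((g : Aˣ) : A) = (l.map j).prod := by
  obtain ⟨g, hg⟩ := g
  change ∃ l : List V, (∀ v ∈ l, Q v = 1 ∨ Q v = -1) ∧ (g : A) = (l.map j).prod
  induction hg using Subgroup.closure_induction'' with
  | one => exact ⟨[], by simp, by simp⟩
  | mem u hu =>
    obtain ⟨v, hv, hu⟩ := hu
    exact ⟨[v], by simpa using hv, by simpa using hu⟩
  | inv_mem u hu =>
    obtain ⟨v, hv, hu⟩ := hu
    refine ⟨[(Q v)⁻¹ • v], ?_, ?_⟩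
    · simp only [List.mem_singleton, forall_eq, QuadraticMap.map_smul]
      rcases hv with h | h <;> rw [h] <;> norm_num
    · rw [units_inv_eq_of_mul_self hj (ne_zero_of_eq_one_or hv) hu]
      simp
  | mul x y _ _ hx hy =>
    obtain ⟨l, hl, hx⟩ := hx
    obtain ⟨l', hl', hy⟩ := hy
    refine ⟨l ++ l', fun v hv => ?_, ?_⟩
    · exact (List.mem_append.mp hv).elim (hl v) (hl' v)
    · rw [Units.val_mul, hx, hy, List.map_append, List.prod_append]

/-- If `s` is an endomorphism of the algebra with `s (j v) = j (-v)`, then the twisted conjugation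
`a ↦ s(g) a g⁻¹` by an element `g` of `pinOf Q j` preserves the vectors, and is a product of
reflections on them. -/
theorem exists_twisted_conj_eq (hj : ∀ v, j v * j v = algebraMap ℝ A (Q v))
    {s : A →ₐ[ℝ] A} (hs : ∀ v, s (j v) = j (-v)) (g : pinOf Q j) :
    ∃ f ∈ Subgroup.closure (unitReflections Q),
      ∀ y, j (f y) = s (g : Aˣ) * j y * (((g : Aˣ)⁻¹ : Aˣ) : A) := by
  obtain ⟨g, hg⟩ := g
  change ∃ f ∈ Subgroup.closure (unitReflections Q), ∀ y, j (f y) = s g * j y * ((g⁻¹ : Aˣ) : A)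
  induction hg using Subgroup.closure_induction with
  | one => exact ⟨1, one_mem _, by simp⟩
  | mem u hu =>
    obtain ⟨v, hv, hu⟩ := hu
    refine ⟨orthoReflection Q v (ne_zero_of_eq_one_or hv),
      Subgroup.subset_closure ⟨v, _, hv, rfl⟩, fun y => ?_⟩
    rw [hu, hs, neg_mul_mul_inv_eq_orthoReflection hj _ hu]
  | inv x _ hx =>
    obtain ⟨f, hf, hx⟩ := hx
    refine ⟨f⁻¹, inv_mem hf, fun y => ?_⟩
    have h1 : s ((x⁻¹ : Aˣ) : A) * s (x : A) = 1 := by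
      rw [← map_mul, Units.inv_mul, map_one]
    have h2 := hx (f⁻¹ y)
    rw [← LinearEquiv.mul_apply, mul_inv_cancel, LinearEquiv.coe_one, id] at h2
    rw [h2, inv_inv, mul_assoc, mul_assoc, Units.inv_mul, mul_one, ← mul_assoc, h1, one_mul]
  | mul x y _ _ hx hy =>
    obtain ⟨f, hf, hx⟩ := hx
    obtain ⟨f', hf', hy⟩ := hy
    refine ⟨f * f', mul_mem hf hf', fun z => ?_⟩
    rw [LinearEquiv.mul_apply, hx, hy, Units.val_mul, map_mul, mul_inv_rev, Units.val_mul]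
    simp only [mul_assoc]

/-- The twisted adjoint representation `g ↦ (y ↦ s(g) y g⁻¹)`. -/
theorem exists_twistedAdjoint (hj : ∀ v, j v * j v = algebraMap ℝ A (Q v))
    (hinj : Function.Injective j) {s : A →ₐ[ℝ] A} (hs : ∀ v, s (j v) = j (-v)) :
    ∃ R : pinOf Q j →* orthogonalGrp Q, ∀ g y,
      j ((R g : V ≃ₗ[ℝ] V) y) = s (g : Aˣ) * j y * (((g : Aˣ)⁻¹ : Aˣ) : A) := by
  choose f hf hfj using exists_twisted_conj_eq hj hs
  refine ⟨MonoidHom.mk' (fun g => ⟨f g, closure_unitReflections_le Q (hf g)⟩) fun g g' => ?_, hfj⟩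
  refine Subtype.ext (LinearEquiv.ext fun y => hinj ?_)
  change j (f (g * g') y) = j (f g (f g' y))
  rw [hfj, hfj, hfj, Subgroup.coe_mul, Units.val_mul, map_mul, mul_inv_rev, Units.val_mul]
  simp only [mul_assoc]

variable {s : A →ₐ[ℝ] A} {R : pinOf Q j →* orthogonalGrp Q}

theorem twistedAdjoint_of_eq (hj : ∀ v, j v * j v = algebraMap ℝ A (Q v))
    (hinj : Function.Injective j) (hs : ∀ v, s (j v) = j (-v))
    (hR : ∀ g y, j ((R g : V ≃ₗ[ℝ] V) y) = s (g : Aˣ) * j y * (((g : Aˣ)⁻¹ : Aˣ) : A))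
    {v : V} (hv : Q v ≠ 0) {g : pinOf Q j} (hg : ((g : Aˣ) : A) = j v) :
    (R g : V ≃ₗ[ℝ] V) = orthoReflection Q v hv := by
  refine LinearEquiv.ext fun y => hinj ?_
  rw [hR, hg, hs, neg_mul_mul_inv_eq_orthoReflection hj hv hg]

theorem twistedAdjoint_surjective (hj : ∀ v, j v * j v = algebraMap ℝ A (Q v))
    (hinj : Function.Injective j) (hs : ∀ v, s (j v) = j (-v))
    (hR : ∀ g y, j ((R g : V ≃ₗ[ℝ] V) y) = s (g : Aˣ) * j y * (((g : Aˣ)⁻¹ : Aˣ) : A))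
    (hQ : Subgroup.closure (unitReflections Q) = orthogonalGrp Q) :
    Function.Surjective R := by
  have h : orthogonalGrp Q ≤ ((orthogonalGrp Q).subtype.comp R).range := by
    refine hQ.symm.le.trans ((Subgroup.closure_le _).mpr ?_)
    rintro _ ⟨v, hv, hv1, rfl⟩
    obtain ⟨g, hg⟩ := exists_unit_eq hj hv1
    exact ⟨g, twistedAdjoint_of_eq hj hinj hs hR hv hg⟩
  rintro ⟨f, hf⟩
  obtain ⟨g, hg⟩ := h hf
  exact ⟨g, Subtype.ext hg⟩

/-- The twisted adjoint action of a product of unit vectors is the composition of the reflections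
along them, the last one being applied first. -/
theorem twistedAdjoint_list_apply (hj : ∀ v, j v * j v = algebraMap ℝ A (Q v))
    (hinj : Function.Injective j) (hs : ∀ v, s (j v) = j (-v))
    (hR : ∀ g y, j ((R g : V ≃ₗ[ℝ] V) y) = s (g : Aˣ) * j y * (((g : Aˣ)⁻¹ : Aˣ) : A))
    (l : List V) (hl : ∀ v ∈ l, Q v = 1 ∨ Q v = -1) (g : pinOf Q j)
    (hg : ((g : Aˣ) : A) = (l.map j).prod) (y : V) :
    (R g : V ≃ₗ[ℝ] V) y =
      l.foldr (fun v x => x - ((Q v)⁻¹ * QuadraticMap.polar Q v x) • v) y := by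
  induction l generalizing g with
  | nil =>
    obtain rfl : g = 1 := Subtype.ext (Units.ext hg)
    rw [map_one]
    rfl
  | cons v l ih =>
    have hv := hl v (by simp)
    obtain ⟨u, hu⟩ := exists_unit_eq hj hv
    have h1 : (((u⁻¹ * g : pinOf Q j) : Aˣ) : A) = (l.map j).prod := by
      rw [Subgroup.coe_mul, Units.val_mul, hg, List.map_cons, List.prod_cons, ← hu, ← mul_assoc,
        Subgroup.coe_inv, Units.inv_mul, one_mul]
    have h2 := ih (fun w hw => hl w (by simp [hw])) _ h1
    rw [← mul_inv_cancel_left u g, map_mul, Subgroup.coe_mul, LinearEquiv.mul_apply, h2,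
      twistedAdjoint_of_eq hj hinj hs hR (ne_zero_of_eq_one_or hv) hu, orthoReflection_apply]
    rfl

theorem det_twistedAdjoint [Module.Finite ℝ V] (hj : ∀ v, j v * j v = algebraMap ℝ A (Q v))
    (hinj : Function.Injective j) (hs : ∀ v, s (j v) = j (-v))
    (hR : ∀ g y, j ((R g : V ≃ₗ[ℝ] V) y) = s (g : Aˣ) * j y * (((g : Aˣ)⁻¹ : Aˣ) : A))
    (l : List V) (hl : ∀ v ∈ l, Q v = 1 ∨ Q v = -1) (g : pinOf Q j)
    (hg : ((g : Aˣ) : A) = (l.map j).prod) :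
    LinearEquiv.det (R g : V ≃ₗ[ℝ] V) = (-1) ^ l.length := by
  induction l generalizing g with
  | nil =>
    obtain rfl : g = 1 := Subtype.ext (Units.ext hg)
    rw [map_one, OneMemClass.coe_one, map_one, List.length_nil, pow_zero]
  | cons v l ih =>
    have hv := hl v (by simp)
    obtain ⟨u, hu⟩ := exists_unit_eq hj hv
    have h1 : (((u⁻¹ * g : pinOf Q j) : Aˣ) : A) = (l.map j).prod := by
      rw [Subgroup.coe_mul, Units.val_mul, hg, List.map_cons, List.prod_cons, ← hu, ← mul_assoc,
        Subgroup.coe_inv, Units.inv_mul, one_mul]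
    have h2 := ih (fun w hw => hl w (by simp [hw])) _ h1
    rw [← mul_inv_cancel_left u g, map_mul, Subgroup.coe_mul, map_mul, h2,
      twistedAdjoint_of_eq hj hinj hs hR (ne_zero_of_eq_one_or hv) hu, det_orthoReflection,
      List.length_cons, pow_succ']

/-- A product of an even number of unit vectors is a product of pairs of unit vectors. -/
theorem exists_spinOf_eq (hj : ∀ v, j v * j v = algebraMap ℝ A (Q v)) :
    ∀ l : List V, (∀ v ∈ l, Q v = 1 ∨ Q v = -1) → Even l.length →
      ∃ g ∈ spinOf Q j, ((g : Aˣ) : A) = (l.map j).prod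
  | [], _, _ => ⟨1, one_mem _, rfl⟩
  | [_], _, h => absurd h Nat.not_even_one
  | v :: w :: l, hl, h => by
    have hv := hl v (by simp)
    have hw := hl w (by simp)
    obtain ⟨g, hg, hgl⟩ := exists_spinOf_eq hj l (fun x hx => hl x (by simp [hx]))
      (by simpa [Nat.even_add_one] using h)
    obtain ⟨a, ha⟩ := exists_unit_eq hj hv
    obtain ⟨b, hb⟩ := exists_unit_eq hj hw
    have hab : (((a * b : pinOf Q j) : Aˣ) : A) = j v * j w := by
      rw [Subgroup.coe_mul, Units.val_mul, ha, hb]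
    refine ⟨a * b * g, mul_mem (Subgroup.subset_closure ⟨v, w, hv, hw, hab⟩) hg, ?_⟩
    rw [Subgroup.coe_mul, Units.val_mul, hab, hgl, List.map_cons, List.map_cons, List.prod_cons,
      List.prod_cons, mul_assoc]

/-- An element of `pinOf` that maps to a rotation is a product of an even number of unit vectors, by
the determinant; so it lies in `spinOf`. -/
theorem exists_spinOf_hom [Module.Finite ℝ V] (hj : ∀ v, j v * j v = algebraMap ℝ A (Q v))
    (hinj : Function.Injective j) (hs : ∀ v, s (j v) = j (-v))
    (hR : ∀ g y, j ((R g : V ≃ₗ[ℝ] V) y) = s (g : Aˣ) * j y * (((g : Aˣ)⁻¹ : Aˣ) : A))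
    (hQ : Subgroup.closure (unitReflections Q) = orthogonalGrp Q) :
    ∃ S : spinOf Q j →* specialOrthogonalGrp Q, Function.Surjective S ∧
      ∀ g : spinOf Q j, (S g : V ≃ₗ[ℝ] V) = R (g : pinOf Q j) := by
  let R' : pinOf Q j →* (V ≃ₗ[ℝ] V) := (orthogonalGrp Q).subtype.comp R
  have hle : spinOf Q j ≤ (specialOrthogonalGrp Q).comap R' := by
    refine (Subgroup.closure_le _).mpr ?_
    rintro g ⟨v, w, hv, hw, hg⟩
    refine ⟨(R g).2, ?_⟩
    have := det_twistedAdjoint hj hinj hs hR [v, w] (by simpa using ⟨hv, hw⟩) g (by simpa using hg)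
    exact this.trans (by simp)
  refine ⟨(R'.comp (spinOf Q j).subtype).codRestrict (specialOrthogonalGrp Q)
    (fun g => hle g.2), ?_, fun g => rfl⟩
  rintro ⟨f, hf, hdet⟩
  obtain ⟨g, hg⟩ := twistedAdjoint_surjective hj hinj hs hR hQ ⟨f, hf⟩
  obtain ⟨l, hl, hgl⟩ := exists_list_of_pinOf hj g
  have heven : Even l.length := by
    have h1 := det_twistedAdjoint hj hinj hs hR l hl g hgl
    rw [hg] at h1
    have h2 : LinearEquiv.det f = 1 := hdet
    by_contra hodd
    rw [h2, (Nat.not_even_iff_odd.mp hodd).neg_one_pow] at h1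
    have h3 : (1 : ℝ) = -1 := by simpa using congrArg Units.val h1
    norm_num at h3
  obtain ⟨g', hg', hgl'⟩ := exists_spinOf_eq hj l hl heven
  obtain rfl : g' = g := Subtype.ext (Units.ext (hgl'.trans hgl.symm))
  have hgf : (R g' : V ≃ₗ[ℝ] V) = f := by rw [hg]
  exact ⟨⟨g', hg'⟩, Subtype.ext hgf⟩

theorem closure_twistedAdjoint_pairs [Module.Finite ℝ V]
    (hj : ∀ v, j v * j v = algebraMap ℝ A (Q v))
    (hinj : Function.Injective j) (hs : ∀ v, s (j v) = j (-v))
    (hR : ∀ g y, j ((R g : V ≃ₗ[ℝ] V) y) = s (g : Aˣ) * j y * (((g : Aˣ)⁻¹ : Aˣ) : A))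
    (hQ : Subgroup.closure (unitReflections Q) = orthogonalGrp Q) :
    Subgroup.closure {f | ∃ (g : pinOf Q j) (v w : V), (Q v = 1 ∨ Q v = -1) ∧
      (Q w = 1 ∨ Q w = -1) ∧ ((g : Aˣ) : A) = j v * j w ∧ f = (R g : V ≃ₗ[ℝ] V)} =
      specialOrthogonalGrp Q := by
  obtain ⟨S, hS, hSR⟩ := exists_spinOf_hom hj hinj hs hR hQ
  refine le_antisymm ((Subgroup.closure_le _).mpr ?_) fun f hf => ?_
  · rintro _ ⟨g, v, w, hv, hw, hg, rfl⟩
    have hgs : g ∈ spinOf Q j := Subgroup.subset_closure ⟨v, w, hv, hw, hg⟩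
    rw [← hSR ⟨g, hgs⟩]
    exact (S ⟨g, hgs⟩).2
  · obtain ⟨⟨g, hg⟩, hgf⟩ := hS ⟨f, hf⟩
    have hfR : f = R g := (congrArg Subtype.val hgf).symm.trans (hSR ⟨g, hg⟩)
    rw [hfR]
    clear hfR hgf
    have hle : spinOf Q j ≤ (Subgroup.closure {f | ∃ (g : pinOf Q j) (v w : V),
        (Q v = 1 ∨ Q v = -1) ∧ (Q w = 1 ∨ Q w = -1) ∧ ((g : Aˣ) : A) = j v * j w ∧
        f = (R g : V ≃ₗ[ℝ] V)}).comap ((orthogonalGrp Q).subtype.comp R) := by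
      refine (Subgroup.closure_le _).mpr ?_
      rintro g ⟨v, w, hv, hw, hg⟩
      exact Subgroup.subset_closure ⟨g, v, w, hv, hw, hg, rfl⟩
    exact hle hg

end TwistedConjugation

section Transport

variable {V W : Type*} [AddCommGroup V] [Module ℝ V] [AddCommGroup W] [Module ℝ W]

/-- Conjugation by an isometry identifies the special orthogonal groups. -/
theorem exists_specialOrthogonalGrp_hom {Q : QuadraticForm ℝ V} {Q' : QuadraticForm ℝ W}
    (e : Q.IsometryEquiv Q') :
    ∃ α : specialOrthogonalGrp Q →* (W ≃ₗ[ℝ] W), Function.Injective α ∧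
      (∀ h x, α h (e x) = e ((h : V ≃ₗ[ℝ] V) x)) ∧ α.range = specialOrthogonalGrp Q' := by
  let α : specialOrthogonalGrp Q →* (W ≃ₗ[ℝ] W) := MonoidHom.mk'
    (fun h => (e.toLinearEquiv.symm.trans (h : V ≃ₗ[ℝ] V)).trans e.toLinearEquiv) (by
      intro g h
      ext x
      change e ((g : V ≃ₗ[ℝ] V) ((h : V ≃ₗ[ℝ] V) (e.symm x))) =
        e ((g : V ≃ₗ[ℝ] V) (e.symm (e ((h : V ≃ₗ[ℝ] V) (e.symm x)))))
      rw [e.symm_apply_apply])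
  have hα : ∀ h x, α h (e x) = e ((h : V ≃ₗ[ℝ] V) x) := by
    intro h x
    change e ((h : V ≃ₗ[ℝ] V) (e.symm (e x))) = _
    rw [e.symm_apply_apply]
  refine ⟨α, ?_, hα, le_antisymm ?_ ?_⟩
  · intro g h hgh
    refine Subtype.ext (LinearEquiv.ext fun x => e.toLinearEquiv.injective ?_)
    change e _ = e _
    rw [← hα, ← hα, hgh]
  · rintro _ ⟨h, rfl⟩
    refine ⟨fun x => ?_, ?_⟩
    · change Q' (e ((h : V ≃ₗ[ℝ] V) (e.symm x))) = _
      rw [e.map_app, h.2.1, e.symm.map_app]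
    · change LinearEquiv.det _ = 1
      rw [← Units.val_inj]
      rw [LinearEquiv.coe_det]
      exact (LinearMap.det_conj (h : V ≃ₗ[ℝ] V).toLinearMap e.toLinearEquiv).trans
        ((LinearEquiv.coe_det _).symm.trans (congrArg Units.val h.2.2))
  · rintro f ⟨hf, hdet⟩
    refine ⟨⟨(e.toLinearEquiv.trans f).trans e.toLinearEquiv.symm, fun x => ?_, ?_⟩, ?_⟩
    · change Q (e.symm (f (e x))) = _
      rw [e.symm.map_app, hf, e.map_app]
    · change LinearEquiv.det _ = 1
      rw [← Units.val_inj]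
      rw [LinearEquiv.coe_det]
      exact (LinearMap.det_conj f.toLinearMap e.toLinearEquiv.symm).trans
        ((LinearEquiv.coe_det _).symm.trans (congrArg Units.val hdet))
    · ext x
      change e (e.symm (f (e (e.symm x)))) = f x
      rw [e.apply_symm_apply, e.apply_symm_apply]

end Transport

/-! ### Composition algebras -/

section Composition

variable {K : Type*} [NonAssocRing K] [Module ℝ K] [CompositionAlgebra K]

open CompositionAlgebra QuadraticMap

theorem eq_of_polar_nsq_eq {x y : K}
    (h : ∀ w, polar (nsq : QuadraticForm ℝ K) x w = polar (nsq : QuadraticForm ℝ K) y w) :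
    x = y := by
  rw [← sub_eq_zero]
  refine (nsq_nondegenerate (K := K)).1 _ fun w => ?_
  rw [polarBilin_apply_apply, polar_sub_left, h, sub_self]

theorem polar_nsq_mul_left (x y z : K) :
    polar (nsq : QuadraticForm ℝ K) (x * y) (x * z) =
      (nsq : QuadraticForm ℝ K) x * polar (nsq : QuadraticForm ℝ K) y z := by
  simp only [polar, ← mul_add, nsq_mul]
  ring

theorem polar_nsq_mul_right (x y z : K) :
    polar (nsq : QuadraticForm ℝ K) (x * z) (y * z) =
      polar (nsq : QuadraticForm ℝ K) x y * (nsq : QuadraticForm ℝ K) z := by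
  simp only [polar, ← add_mul, nsq_mul]
  ring

/-- The complete polarization of `|x y|² = |x|² |y|²`. -/
theorem polar_nsq_mul_add (x y z w : K) :
    polar (nsq : QuadraticForm ℝ K) (x * y) (z * w) +
      polar (nsq : QuadraticForm ℝ K) (z * y) (x * w) =
      polar (nsq : QuadraticForm ℝ K) x z * polar (nsq : QuadraticForm ℝ K) y w := by
  have h := polar_nsq_mul_left (x + z) y w
  rw [add_mul, add_mul, polar_add_left, polar_add_right, polar_add_right, polar_nsq_mul_left,
    polar_nsq_mul_left, QuadraticMap.map_add nsq x z] at h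
  linarith

theorem conjL_apply (x : K) :
    conjL x = polar (nsq : QuadraticForm ℝ K) 1 x • (1 : K) - x := by
  simp [conjL, reL, smul_smul]

theorem nsq_one : (nsq : QuadraticForm ℝ K) 1 = 1 := by
  have h : (nsq : QuadraticForm ℝ K) 1 * nsq (1 : K) = nsq (1 : K) := by
    rw [← nsq_mul, one_mul]
  rcases eq_or_ne ((nsq : QuadraticForm ℝ K) 1) 0 with h0 | h0
  · refine absurd (eq_of_polar_nsq_eq (x := (1 : K)) (y := 0) fun w => ?_) one_ne_zero
    have hz : ∀ x : K, (nsq : QuadraticForm ℝ K) x = 0 := fun x => by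
      rw [← one_mul x, nsq_mul, h0, zero_mul]
    simp [polar, hz]
  · exact mul_right_cancel₀ h0 (h.trans (one_mul _).symm)

theorem reL_one : reL (1 : K) = 1 := by
  simp [reL, polar_self, nsq_one]

theorem polar_nsq_one_conjL (x : K) :
    polar (nsq : QuadraticForm ℝ K) 1 (conjL x) = polar (nsq : QuadraticForm ℝ K) 1 x := by
  rw [conjL_apply, polar_sub_right, polar_smul_right, polar_self, nsq_one]
  simp only [smul_eq_mul, nsmul_eq_mul]
  push_cast
  ring

theorem conjL_conjL (x : K) : conjL (conjL x) = x := by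
  rw [conjL_apply (conjL x), polar_nsq_one_conjL, conjL_apply, sub_sub_cancel]

theorem nsq_conjL (x : K) : (nsq : QuadraticForm ℝ K) (conjL x) = nsq x := by
  rw [conjL_apply, ← QuadraticMap.map_neg, neg_sub, quadraticForm_sub_smul, nsq_one]
  ring

/-- Left multiplication by the conjugate is adjoint to left multiplication. -/
theorem polar_nsq_conjL_mul (x y w : K) :
    polar (nsq : QuadraticForm ℝ K) (conjL x * y) w =
      polar (nsq : QuadraticForm ℝ K) y (x * w) := by
  have h := polar_nsq_mul_add x y 1 w
  rw [one_mul, one_mul] at h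
  rw [conjL_apply, sub_mul, smul_mul_assoc, one_mul, polar_sub_left, polar_smul_left,
    polar_comm _ 1 x, smul_eq_mul]
  linarith

/-- Right multiplication by the conjugate is adjoint to right multiplication. -/
theorem polar_nsq_mul_conjL (x y w : K) :
    polar (nsq : QuadraticForm ℝ K) (x * conjL y) w =
      polar (nsq : QuadraticForm ℝ K) x (w * y) := by
  have h := polar_nsq_mul_add x y w 1
  rw [mul_one, mul_one] at h
  rw [conjL_apply, mul_sub, mul_smul_comm, mul_one, polar_sub_left, polar_smul_left,
    polar_comm _ 1 y, smul_eq_mul, polar_comm _ x (w * y)]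
  linarith

theorem conjL_mul_mul (x y : K) : conjL x * (x * y) = (nsq : QuadraticForm ℝ K) x • y :=
  eq_of_polar_nsq_eq fun w => by
    rw [polar_nsq_conjL_mul, polar_nsq_mul_left, polar_smul_left, smul_eq_mul]

theorem mul_conjL_mul (x y : K) : x * (conjL x * y) = (nsq : QuadraticForm ℝ K) x • y := by
  have h := conjL_mul_mul (conjL x) y
  rwa [conjL_conjL, nsq_conjL] at h

theorem mul_mul_conjL (x y : K) : y * x * conjL x = (nsq : QuadraticForm ℝ K) x • y :=
  eq_of_polar_nsq_eq fun w => by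
    rw [polar_nsq_mul_conjL, polar_nsq_mul_right, polar_smul_left, smul_eq_mul, mul_comm]

theorem mul_conjL_mul_self (x y : K) : y * conjL x * x = (nsq : QuadraticForm ℝ K) x • y := by
  have h := mul_mul_conjL (conjL x) y
  rwa [conjL_conjL, nsq_conjL] at h

theorem conjL_mul_self (x : K) : conjL x * x = (nsq : QuadraticForm ℝ K) x • (1 : K) := by
  simpa using conjL_mul_mul x 1

theorem mul_conjL_self (x : K) : x * conjL x = (nsq : QuadraticForm ℝ K) x • (1 : K) := by
  simpa using mul_conjL_mul x 1

theorem tmul_one_injective {W : Type*} [AddCommGroup W] [Module ℝ W] :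
    Function.Injective fun A : W => A ⊗ₜ[ℝ] (1 : K) := by
  intro A B h
  have := congrArg (fun t => TensorProduct.rid ℝ W (TensorProduct.map LinearMap.id reL t)) h
  simpa [reL_one] using this

theorem one_tmul_injective {W : Type*} [AddCommGroup W] [Module ℝ W] :
    Function.Injective fun a : W => (1 : K) ⊗ₜ[ℝ] a := by
  intro a b h
  have := congrArg (fun t => TensorProduct.lid ℝ W (TensorProduct.map reL LinearMap.id t)) h
  simpa [reL_one] using this

end Composition

section TensorProducts

variable {K' K : Type*} [NonAssocRing K'] [Module ℝ K'] [CompositionAlgebra K']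
  [NonAssocRing K] [Module ℝ K] [CompositionAlgebra K]

open CompositionAlgebra

theorem tmul_one_mul_one_tmul_mul (A : K') (a : K) (m : K' ⊗[ℝ] K) :
    (A ⊗ₜ[ℝ] (1 : K)) * ((1 ⊗ₜ[ℝ] a) * m) = (1 ⊗ₜ[ℝ] a) * ((A ⊗ₜ[ℝ] 1) * m) := by
  induction m with
  | zero => simp
  | tmul x y => simp [Algebra.TensorProduct.tmul_mul_tmul]
  | add x y hx hy => simp only [mul_add, hx, hy]

theorem mul_tmul_one_mul_one_tmul (A : K') (a : K) (m : K' ⊗[ℝ] K) :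
    m * (A ⊗ₜ[ℝ] (1 : K)) * (1 ⊗ₜ[ℝ] a) = m * (1 ⊗ₜ[ℝ] a) * (A ⊗ₜ[ℝ] 1) := by
  induction m with
  | zero => simp
  | tmul x y => simp [Algebra.TensorProduct.tmul_mul_tmul]
  | add x y hx hy => simp only [add_mul, hx, hy]

theorem tmul_one_mul_mul_of {A B : K'} {c : ℝ} (h : ∀ y, A * (B * y) = c • y) (m : K' ⊗[ℝ] K) :
    (A ⊗ₜ[ℝ] (1 : K)) * ((B ⊗ₜ[ℝ] 1) * m) = c • m := by
  induction m with
  | zero => simp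
  | tmul x y => simp [Algebra.TensorProduct.tmul_mul_tmul, h, TensorProduct.smul_tmul']
  | add x y hx hy => simp only [mul_add, hx, hy, smul_add]

theorem one_tmul_mul_mul_of {a b : K} {c : ℝ} (h : ∀ y, a * (b * y) = c • y) (m : K' ⊗[ℝ] K) :
    ((1 : K') ⊗ₜ[ℝ] a) * ((1 ⊗ₜ[ℝ] b) * m) = c • m := by
  induction m with
  | zero => simp
  | tmul x y => simp [Algebra.TensorProduct.tmul_mul_tmul, h]
  | add x y hx hy => simp only [mul_add, hx, hy, smul_add]

theorem mul_mul_tmul_one_of {A B : K'} {c : ℝ} (h : ∀ y, y * A * B = c • y) (m : K' ⊗[ℝ] K) :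
    m * (A ⊗ₜ[ℝ] (1 : K)) * (B ⊗ₜ[ℝ] 1) = c • m := by
  induction m with
  | zero => simp
  | tmul x y => simp [Algebra.TensorProduct.tmul_mul_tmul, h, TensorProduct.smul_tmul']
  | add x y hx hy => simp only [add_mul, hx, hy, smul_add]

theorem mul_mul_one_tmul_of {a b : K} {c : ℝ} (h : ∀ y, y * a * b = c • y) (m : K' ⊗[ℝ] K) :
    m * ((1 : K') ⊗ₜ[ℝ] a) * (1 ⊗ₜ[ℝ] b) = c • m := by
  induction m with
  | zero => simp
  | tmul x y => simp [Algebra.TensorProduct.tmul_mul_tmul, h]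
  | add x y hx hy => simp only [add_mul, hx, hy, smul_add]

/-! ### The matrices `Γ(X)` -/

/-- The matrix `(A, ā; a, -A*)`, as a linear function of `(A, a)`. -/
noncomputable def matX : K' × K →ₗ[ℝ] Mat2 K' K where
  toFun x := !![x.1 ⊗ₜ[ℝ] (1 : K), (1 : K') ⊗ₜ[ℝ] conjL x.2;
           (1 : K') ⊗ₜ[ℝ] x.2, -(conjL x.1 ⊗ₜ[ℝ] (1 : K))]
  map_add' x y := by
    ext i j
    fin_cases i <;> fin_cases j <;>
      simp [TensorProduct.add_tmul, TensorProduct.tmul_add, add_comm]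
  map_smul' c x := by
    ext i j
    fin_cases i <;> fin_cases j <;> simp [TensorProduct.smul_tmul']

theorem traceReversal_matX (x : K' × K) : traceReversal K' K (matX x) =
    !![conjL x.1 ⊗ₜ[ℝ] (1 : K), (1 : K') ⊗ₜ[ℝ] conjL x.2;
       (1 : K') ⊗ₜ[ℝ] x.2, -(x.1 ⊗ₜ[ℝ] (1 : K))] := by
  ext i j
  fin_cases i <;> fin_cases j <;> simp [traceReversal, matX, Matrix.trace_fin_two]

theorem Gam_matX (x : K' × K) : Gam K' K (matX x) = Matrix.fromBlocks 0
    !![x.1 ⊗ₜ[ℝ] (1 : K), (1 : K') ⊗ₜ[ℝ] conjL x.2;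
       (1 : K') ⊗ₜ[ℝ] x.2, -(conjL x.1 ⊗ₜ[ℝ] (1 : K))]
    !![conjL x.1 ⊗ₜ[ℝ] (1 : K), (1 : K') ⊗ₜ[ℝ] conjL x.2;
       (1 : K') ⊗ₜ[ℝ] x.2, -(x.1 ⊗ₜ[ℝ] (1 : K))] 0 := by
  rw [← traceReversal_matX]
  rfl

/-- `Γ(X)² = |Γ(X)|²`, also for the operators of left multiplication. -/
theorem Gam_matX_mul_mul (x : K' × K) (M : Mat4 K' K) :
    Gam K' K (matX x) * (Gam K' K (matX x) * M) =
      ((nsq : QuadraticForm ℝ K') x.1 + (nsq : QuadraticForm ℝ K) x.2) • M := by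
  rw [Gam_matX]
  ext i j
  rcases i with i | i <;> fin_cases i <;>
    simp [Matrix.mul_apply, Fintype.sum_sum_type, mul_add, add_smul,
      tmul_one_mul_mul_of (mul_conjL_mul x.1), tmul_one_mul_mul_of (conjL_mul_mul x.1),
      one_tmul_mul_mul_of (mul_conjL_mul x.2), one_tmul_mul_mul_of (conjL_mul_mul x.2),
      tmul_one_mul_one_tmul_mul] <;> abel

/-- The counterpart of `Gam_matX_mul_mul` for right multiplication. -/
theorem mul_mul_Gam_matX (x : K' × K) (M : Mat4 K' K) :
    M * Gam K' K (matX x) * Gam K' K (matX x) =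
      ((nsq : QuadraticForm ℝ K') x.1 + (nsq : QuadraticForm ℝ K) x.2) • M := by
  rw [Gam_matX]
  ext i j
  rcases j with j | j <;> fin_cases j <;>
    simp [Matrix.mul_apply, Fintype.sum_sum_type, add_mul, add_smul,
      mul_mul_tmul_one_of (mul_mul_conjL x.1), mul_mul_tmul_one_of (mul_conjL_mul_self x.1),
      mul_mul_one_tmul_of (mul_mul_conjL x.2), mul_mul_one_tmul_of (mul_conjL_mul_self x.2),
      mul_tmul_one_mul_one_tmul] <;> abel

theorem negDet_matX (x : K' × K) :
    negDet K' K (matX x) = (nsq : QuadraticForm ℝ K') x.1 + (nsq : QuadraticForm ℝ K) x.2 := by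
  simp [negDet, matX, reTensor, Algebra.TensorProduct.tmul_mul_tmul, conjL_mul_self,
    mul_conjL_self, reL_one, add_comm]

theorem matX_injective : Function.Injective (matX : K' × K →ₗ[ℝ] Mat2 K' K) := by
  intro x y h
  refine Prod.ext ?_ ?_
  · exact tmul_one_injective (K := K) (congrFun (congrFun h 0) 0)
  · exact one_tmul_injective (K := K') (congrFun (congrFun h 1) 0)

variable (K' K) in
/-- The identification of `K' ⊕ K`, with the sum of the two norm forms, and `V₄`. -/
noncomputable def isometryV4 :
    (QuadraticMap.prod (nsq : QuadraticForm ℝ K') (nsq : QuadraticForm ℝ K)).IsometryEquiv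
      (V4form K' K) where
  toLinearEquiv := LinearEquiv.ofBijective
    (((Gam K' K) ∘ₗ matX).codRestrict (V4 K' K) fun x => ⟨matX x, ⟨x.1, x.2, rfl⟩, rfl⟩) (by
      constructor
      · intro x y h
        exact matX_injective (congrArg (upperRight K' K) (congrArg Subtype.val h))
      · rintro ⟨_, X, ⟨A, a, rfl⟩, rfl⟩
        exact ⟨(A, a), rfl⟩)
  map_app' x := negDet_matX x

theorem coe_isometryV4 (x : K' × K) :
    (isometryV4 K' K x : Mat4 K' K) = Gam K' K (matX x) := rfl

theorem isometryV4_surjective : Function.Surjective (isometryV4 K' K) :=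
  (isometryV4 K' K).toLinearEquiv.surjective

theorem V4_mul_mul (P : V4 K' K) (M : Mat4 K' K) :
    (P : Mat4 K' K) * (P * M) = V4form K' K P • M := by
  obtain ⟨x, rfl⟩ := isometryV4_surjective P
  rw [coe_isometryV4, Gam_matX_mul_mul, (isometryV4 K' K).map_app, QuadraticMap.prod_apply]

theorem mul_mul_V4 (P : V4 K' K) (M : Mat4 K' K) :
    M * (P : Mat4 K' K) * P = V4form K' K P • M := by
  obtain ⟨x, rfl⟩ := isometryV4_surjective P
  rw [coe_isometryV4, mul_mul_Gam_matX, (isometryV4 K' K).map_app, QuadraticMap.prod_apply]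

end TensorProducts

/-! ### Signatures -/

section Signature

open QuadraticMap

theorem equivalent_weightedSumSquares_comp {ι κ : Type*} [Fintype ι] [Fintype κ] (σ : ι ≃ κ)
    (w : κ → ℝ) :
    Equivalent (weightedSumSquares ℝ w) (weightedSumSquares ℝ (w ∘ σ)) :=
  ⟨{ LinearEquiv.funCongrLeft ℝ ℝ σ with
      map_app' := fun x => by
        simp only [weightedSumSquares_apply]
        exact σ.sum_comp fun i => w i • (x i * x i) }⟩

theorem equivalent_prod_weightedSumSquares {ι κ : Type*} [Fintype ι] [Fintype κ] (w : ι → ℝ)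
    (w' : κ → ℝ) :
    Equivalent ((weightedSumSquares ℝ w).prod (weightedSumSquares ℝ w'))
      (weightedSumSquares ℝ (Sum.elim w w')) :=
  ⟨{ (LinearEquiv.sumArrowLequivProdArrow ι κ ℝ ℝ).symm with
      map_app' := fun x => by
        change weightedSumSquares ℝ (Sum.elim w w') (Sum.elim x.1 x.2) = _
        simp [weightedSumSquares_apply, Fintype.sum_sum_type] }⟩

/-- Sorting the signs of a diagonal form with coefficients `±1`. -/
theorem equivalent_stdForm {ι : Type*} [Fintype ι] {w : ι → ℝ} (hw : ∀ i, w i = -1 ∨ w i = 1) :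
    Equivalent (weightedSumSquares ℝ w) (stdForm (sigPos (weightedSumSquares ℝ w))
      (sigNeg (weightedSumSquares ℝ w))) := by
  classical
  have hneg : ∀ i, w i < 0 ↔ ¬ 0 < w i := fun i => by
    rcases hw i with h | h <;> rw [h] <;> norm_num
  have hp : Nat.card {i // 0 < w i} = sigPos (weightedSumSquares ℝ w) := by
    rw [QuadraticForm.sigPos_weightedSumSquares]
    exact Nat.card_coe_set_eq {i | 0 < w i}
  have hq : Nat.card {i // ¬ 0 < w i} = sigNeg (weightedSumSquares ℝ w) := by
    rw [QuadraticForm.sigNeg_weightedSumSquares]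
    simp only [hneg]
    exact Nat.card_coe_set_eq {i | ¬ 0 < w i}
  let ep := Finite.equivFinOfCardEq hp
  let en := Finite.equivFinOfCardEq hq
  let σ := (Equiv.sumCongr ep.symm en.symm).trans (Equiv.sumCompl fun i => 0 < w i)
  have hσ : w ∘ σ = Sum.elim (fun _ => (1 : ℝ)) (fun _ => (-1 : ℝ)) := by
    funext i
    rcases i with i | i
    · have h := (ep.symm i).2
      rcases hw (ep.symm i) with h' | h'
      · rw [h'] at h
        norm_num at h
      · exact h'
    · have h := (en.symm i).2
      rcases hw (en.symm i) with h' | h'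
      · exact h'
      · rw [h'] at h
        norm_num at h
  have h := equivalent_weightedSumSquares_comp σ w
  rw [hσ] at h
  exact h

theorem separatingLeft_associated {M : Type*} [AddCommGroup M] [Module ℝ M]
    {Q : QuadraticForm ℝ M} (hQ : (polarBilin Q).Nondegenerate) :
    (associated (R := ℝ) Q).SeparatingLeft := by
  intro x hx
  refine hQ.1 x fun y => ?_
  rw [← LinearMap.congr_fun₂ (two_nsmul_associated ℝ Q) x y, LinearMap.smul_apply,
    LinearMap.smul_apply, hx y, smul_zero]

variable {M N : Type*} [AddCommGroup M] [Module ℝ M] [Module.Finite ℝ M]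
  [AddCommGroup N] [Module ℝ N] [Module.Finite ℝ N]

theorem card_pos_sum_elim {ι κ : Type*} [Fintype ι] [Fintype κ] (w : ι → ℝ) (w' : κ → ℝ)
    (p : ℝ → Prop) :
    {i | p (Sum.elim w w' i)}.ncard = {i | p (w i)}.ncard + {i | p (w' i)}.ncard := by
  simp only [← Nat.card_coe_set_eq]
  rw [← Nat.card_sum]
  exact Nat.card_congr (Equiv.subtypeSum (p := fun i => p (Sum.elim w w' i)))

/-- The signature of an orthogonal sum. -/
theorem equivalent_prod_stdForm {Q : QuadraticForm ℝ M} {Q' : QuadraticForm ℝ N}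
    (hQ : (polarBilin Q).Nondegenerate) (hQ' : (polarBilin Q').Nondegenerate) :
    Equivalent (Q.prod Q') (stdForm (sigPos Q + sigPos Q') (sigNeg Q + sigNeg Q')) := by
  obtain ⟨w, hw, ⟨e⟩⟩ :=
    QuadraticForm.equivalent_one_neg_one_weighted_sum_squared Q (separatingLeft_associated hQ)
  obtain ⟨w', hw', ⟨e'⟩⟩ :=
    QuadraticForm.equivalent_one_neg_one_weighted_sum_squared Q' (separatingLeft_associated hQ')
  have h : Equivalent (Q.prod Q') (weightedSumSquares ℝ (Sum.elim w w')) :=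
    Equivalent.trans ⟨e.prod e'⟩ (equivalent_prod_weightedSumSquares w w')
  have h' := h.trans (equivalent_stdForm (w := Sum.elim w w') (by
    rintro (i | i)
    · exact hw i
    · exact hw' i))
  rwa [QuadraticForm.sigPos_weightedSumSquares, QuadraticForm.sigNeg_weightedSumSquares,
    card_pos_sum_elim w w' (fun r => 0 < r), card_pos_sum_elim w w' (fun r => r < 0),
    ← QuadraticForm.sigPos_of_equiv_weightedSumSquares ⟨e⟩,
    ← QuadraticForm.sigPos_of_equiv_weightedSumSquares ⟨e'⟩,
    ← QuadraticForm.sigNeg_of_equiv_weightedSumSquares ⟨e⟩,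
    ← QuadraticForm.sigNeg_of_equiv_weightedSumSquares ⟨e'⟩] at h'

theorem sigPos_of_posDef {Q : QuadraticForm ℝ M} (hQ : Q.PosDef) :
    sigPos Q = Module.finrank ℝ M := by
  refine le_antisymm (sigPos_le_finrank Q) ?_
  have h : (Q.restrict ⊤).PosDef := fun x hx => hQ x (by simpa using hx)
  simpa using le_sigPos_of_posDef Q h

theorem sigNeg_of_posDef {Q : QuadraticForm ℝ M} (hQ : Q.PosDef) : sigNeg Q = 0 := by
  have := QuadraticForm.sigPos_add_sigNeg_add_radical (Q := Q)
  rw [sigPos_of_posDef hQ] at this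
  omega

theorem exists_orthogonal_basis_of_stdForm {M : Type*} [AddCommGroup M] [Module ℝ M] {p q : ℕ}
    {Q : QuadraticForm ℝ M}
    (e : (stdForm p q).IsometryEquiv Q) :
    ∃ b : Module.Basis (Fin p ⊕ Fin q) ℝ M, (∀ i, Q (b i) ≠ 0) ∧
      Pairwise fun i j => polar Q (b i) (b j) = 0 := by
  have h : ∀ i, (Pi.basisFun ℝ (Fin p ⊕ Fin q)).map e.toLinearEquiv i =
      e (Pi.single i 1) := fun i => by
    rw [Module.Basis.map_apply, Pi.basisFun_apply]
    rfl
  refine ⟨(Pi.basisFun ℝ _).map e.toLinearEquiv, fun i => ?_, fun i j hij => ?_⟩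
  · rw [h, e.map_app]
    rcases i with i | i <;> simp [stdForm, weightedSumSquares_apply, Pi.single_apply]
  · change polar Q _ _ = 0
    rw [h, h, polar, ← map_add, e.map_app, e.map_app, e.map_app]
    change polar (stdForm p q) _ _ = 0
    simp only [stdForm, polar, weightedSumSquares_apply, ← Finset.sum_sub_distrib]
    refine Finset.sum_eq_zero fun k _ => ?_
    rcases eq_or_ne k i with rfl | hki
    · simp [hij]
    · simp [Pi.single_apply, hki]

end Signature

section Assembly

variable {K' K : Type*} [NonAssocRing K'] [Module ℝ K'] [CompositionAlgebra K']
  [NonAssocRing K] [Module ℝ K] [CompositionAlgebra K]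

open CompositionAlgebra

instance finite_V4 : Module.Finite ℝ (V4 K' K) :=
  Module.Finite.equiv (isometryV4 K' K).toLinearEquiv

theorem nonempty_isometryEquiv_V4 (hK : IsNormedDivision K) :
    Nonempty ((stdForm (Module.finrank ℝ K + kappaPos K') (kappaNeg K')).IsometryEquiv
      (V4form K' K)) := by
  have h := equivalent_prod_stdForm (nsq_nondegenerate (K := K')) (nsq_nondegenerate (K := K))
  rw [sigPos_of_posDef hK, sigNeg_of_posDef hK, add_zero, add_comm] at h
  exact h.symm.trans ⟨isometryV4 K' K⟩

/-! ### The Clifford algebra -/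

variable (K' K) in
/-- The map `P ↦ P_L`, as a linear map. -/
noncomputable def toClL : V4 K' K →ₗ[ℝ] Cl K' K where
  toFun := toCl
  map_add' P Q := Subtype.ext (LinearMap.ext fun M => add_mul (P : Mat4 K' K) Q M)
  map_smul' c P := Subtype.ext (LinearMap.ext fun M => smul_mul_assoc c (P : Mat4 K' K) M)

variable (K' K) in
theorem toCl_mul_self (P : V4 K' K) :
    toClL K' K P * toClL K' K P = algebraMap ℝ (Cl K' K) (V4form K' K P) :=
  Subtype.ext (LinearMap.ext fun M => V4_mul_mul P M)

variable (K' K) in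
theorem toCl_injective : Function.Injective (toClL K' K) := by
  intro P Q h
  have h1 := congrArg (fun T : Cl K' K => (T : Module.End ℝ (Mat4 K' K)) 1) h
  refine Subtype.ext ?_
  simpa [toClL, toCl] using h1

theorem toCl_eq_neg_toCl_neg (P : V4 K' K) : toCl P = -toCl (-P) := by
  refine Subtype.ext (LinearMap.ext fun M => ?_)
  change (P : Mat4 K' K) * M = -(((-P : V4 K' K) : Mat4 K' K) * M)
  rw [Submodule.coe_neg, neg_mul, neg_neg]

variable (K' K) in
/-- The map that changes the sign of the two lower rows of blocks. -/
noncomputable def rowSign : Mat4 K' K ≃ₗ[ℝ] Mat4 K' K :=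
  LinearEquiv.ofInvolutive
    { toFun := fun M => Matrix.of fun i j =>
        Sum.elim (fun _ => (1 : ℝ)) (fun _ => (-1 : ℝ)) i • M i j
      map_add' := fun M N => by
        ext i j
        exact smul_add (Sum.elim _ _ i : ℝ) (M i j) (N i j)
      map_smul' := fun c M => by
        ext i j
        exact smul_comm (Sum.elim _ _ i : ℝ) c (M i j) }
    (fun M => by
      ext i j
      change (Sum.elim _ _ i : ℝ) • (Sum.elim _ _ i : ℝ) • M i j = M i j
      rcases i with i | i <;> simp)

theorem rowSign_mul (P : V4 K' K) (M : Mat4 K' K) :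
    rowSign K' K ((P : Mat4 K' K) * M) = -((P : Mat4 K' K) * rowSign K' K M) := by
  obtain ⟨_, X, hX, rfl⟩ := P
  have h : ∀ (M : Mat4 K' K) (i j : Fin 2 ⊕ Fin 2), rowSign K' K M i j =
      Sum.elim (fun _ => (1 : ℝ)) (fun _ => (-1 : ℝ)) i • M i j := fun _ _ _ => rfl
  ext i j
  rcases i with i | i <;>
    simp [h, Gam, Matrix.mul_apply, Fintype.sum_sum_type, add_comm]

variable (K' K) in
/-- The homomorphism from the abstract Clifford algebra that extends `P ↦ P_L`. -/
noncomputable def cliffordToCl : CliffordAlgebra (V4form K' K) →ₐ[ℝ] Cl K' K :=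
  CliffordAlgebra.lift (V4form K' K) ⟨toClL K' K, toCl_mul_self K' K⟩

theorem cliffordToCl_ι (P : V4 K' K) :
    cliffordToCl K' K (CliffordAlgebra.ι (V4form K' K) P) = toCl P :=
  CliffordAlgebra.lift_ι_apply _ _ _

/-- The elements of `V₄` are odd for the block grading of `4 × 4` matrices; so the grade involution
of the Clifford algebra corresponds to the conjugation by `rowSign`. -/
theorem coe_cliffordToCl_involute (x : CliffordAlgebra (V4form K' K)) :
    (cliffordToCl K' K (CliffordAlgebra.involute x) : Module.End ℝ (Mat4 K' K)) =
      (rowSign K' K).conjAlgEquiv ℝ (cliffordToCl K' K x) := by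
  have h : ((Cl K' K).val.comp (cliffordToCl K' K)).comp CliffordAlgebra.involute =
      (((rowSign K' K).conjAlgEquiv ℝ).toAlgHom.comp (Cl K' K).val).comp (cliffordToCl K' K) := by
    ext P : 2
    refine LinearMap.ext fun M => ?_
    change (cliffordToCl K' K (CliffordAlgebra.involute (CliffordAlgebra.ι _ P)) :
      Module.End ℝ (Mat4 K' K)) M = rowSign K' K ((cliffordToCl K' K (CliffordAlgebra.ι _ P) :
      Module.End ℝ (Mat4 K' K)) ((rowSign K' K).symm M))
    rw [CliffordAlgebra.involute_ι, map_neg, cliffordToCl_ι]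
    refine Eq.trans ?_ (rowSign_mul P _).symm
    rw [LinearEquiv.apply_symm_apply]
    rfl
  exact DFunLike.congr_fun h x

theorem cliffordToCl_surjective : Function.Surjective (cliffordToCl K' K) := by
  have h : Cl K' K ≤ ((Cl K' K).val.comp (cliffordToCl K' K)).range := by
    refine Algebra.adjoin_le ?_
    rintro _ ⟨P, hP, rfl⟩
    refine ⟨CliffordAlgebra.ι _ ⟨P, hP⟩, ?_⟩
    exact congrArg Subtype.val (cliffordToCl_ι (⟨P, hP⟩ : V4 K' K))
  rintro ⟨T, hT⟩
  obtain ⟨x, hx⟩ := h hT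
  exact ⟨x, Subtype.ext hx⟩

theorem cliffordToCl_injective (hK : IsNormedDivision K) :
    Function.Injective (cliffordToCl K' K) := by
  obtain ⟨e⟩ := nonempty_isometryEquiv_V4 (K' := K') hK
  obtain ⟨b, hb, hbb⟩ := exists_orthogonal_basis_of_stdForm e
  have : Nontrivial (K' ⊗[ℝ] K) := (tmul_one_injective (K := K) (W := K')).nontrivial
  have hinj := injective_of_involute b hb hbb ((Cl K' K).val.comp (cliffordToCl K' K)) (by
    intro x hx
    have hx' : (cliffordToCl K' K x : Module.End ℝ (Mat4 K' K)) = 0 := hx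
    change (cliffordToCl K' K (CliffordAlgebra.involute x) : Module.End ℝ (Mat4 K' K)) = 0
    rw [coe_cliffordToCl_involute, hx', map_zero])
  exact fun x y hxy => hinj (congrArg Subtype.val hxy)

/-! ### Unit vectors and matrix products -/

theorem mul_vinv {P : V4 K' K} (hP : IsUnitVec P) : (P : Mat4 K' K) * vinv P = 1 := by
  have h := V4_mul_mul P 1
  rw [mul_one] at h
  rw [vinv, mul_smul_comm, h, smul_smul, inv_mul_cancel₀ (ne_zero_of_eq_one_or hP), one_smul]

theorem vinv_mul {P : V4 K' K} (hP : IsUnitVec P) : vinv P * (P : Mat4 K' K) = 1 := by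
  rw [← mul_vinv hP, vinv, mul_smul_comm, smul_mul_assoc]

theorem eq_vinv_of_mul_eq_one {P : V4 K' K} (hP : IsUnitVec P) {Y : Mat4 K' K}
    (hY : (P : Mat4 K' K) * Y = 1) : Y = vinv P := by
  have h := V4_mul_mul P Y
  rw [hY, mul_one] at h
  rw [vinv, h, smul_smul, inv_mul_cancel₀ (ne_zero_of_eq_one_or hP), one_smul]

/-- Both sides equal `2 (P, Q) P - |P|² Q`, by the two Clifford relations for left and right
multiplications. -/
theorem mul_mul_self_assoc (P Q : V4 K' K) :
    ((P : Mat4 K' K) * Q) * P = (P : Mat4 K' K) * ((Q : Mat4 K' K) * P) := by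
  have hr := mul_mul_V4 (P + Q) (P : Mat4 K' K)
  have hl := V4_mul_mul (P + Q) (P : Mat4 K' K)
  have h2 := mul_mul_V4 Q (P : Mat4 K' K)
  have h4 := V4_mul_mul Q (P : Mat4 K' K)
  have hPP : (P : Mat4 K' K) * P = V4form K' K P • (1 : Mat4 K' K) := by
    simpa using V4_mul_mul P 1
  simp only [Submodule.coe_add, add_mul, mul_add, h2, h4, hPP, smul_mul_assoc,
    mul_smul_comm, one_mul, mul_one] at hr hl
  have h := hr.trans hl.symm
  simpa [add_comm, add_left_comm, add_assoc] using h

theorem mul_mul_vinv_assoc (P Q : V4 K' K) :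
    ((P : Mat4 K' K) * Q) * vinv P = (P : Mat4 K' K) * ((Q : Mat4 K' K) * vinv P) := by
  rw [vinv, mul_smul_comm, mul_smul_comm, mul_smul_comm, mul_mul_self_assoc]

/-- The reflection along a unit vector, in terms of matrix products. -/
theorem coe_orthoReflection {P : V4 K' K} (hP : V4form K' K P ≠ 0) (Q : V4 K' K) :
    (orthoReflection (V4form K' K) P hP Q : Mat4 K' K) = -(((P : Mat4 K' K) * Q) * vinv P) := by
  have h1 : (P : Mat4 K' K) * ((Q : Mat4 K' K) * vinv P) +
      (Q : Mat4 K' K) * ((P : Mat4 K' K) * vinv P) =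
      QuadraticMap.polar (V4form K' K) P Q • vinv P := by
    have h := V4_mul_mul (P + Q) (vinv P)
    simp only [Submodule.coe_add, add_mul, mul_add, V4_mul_mul] at h
    rw [QuadraticMap.polar, sub_smul, sub_smul, ← h]
    abel
  have h2 : (P : Mat4 K' K) * vinv P = 1 := by
    have h := V4_mul_mul P 1
    rw [mul_one] at h
    rw [vinv, mul_smul_comm, h, smul_smul, inv_mul_cancel₀ hP, one_smul]
  rw [h2, mul_one] at h1
  rw [mul_mul_vinv_assoc, eq_sub_of_add_eq h1, orthoReflection_apply, Submodule.coe_sub,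
    Submodule.coe_smul, vinv, smul_smul, neg_sub, mul_comm]

/-- A composition of reflections along unit vectors is a nested product of matrices. -/
theorem coe_foldr_eq_nestedConj (l : List (V4 K' K)) (hl : ∀ P ∈ l, IsUnitVec P) (Q : V4 K' K) :
    ((l.foldr (fun P X => X - ((V4form K' K P)⁻¹ * QuadraticMap.polar (V4form K' K) P X) • P) Q :
      V4 K' K) : Mat4 K' K) = (-1 : ℝ) ^ l.length • nestedConj l (Q : Mat4 K' K) := by
  induction l with
  | nil => exact (one_smul ℝ _).symm
  | cons P l ih =>
    have hP := ne_zero_of_eq_one_or (hl P (by simp))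
    rw [List.foldr_cons, ← orthoReflection_apply _ P hP, coe_orthoReflection,
      ih fun w hw => hl w (by simp [hw]), nestedConj, List.length_cons, mul_smul_comm,
      smul_mul_assoc, ← neg_smul, pow_succ, mul_neg_one]

variable (K' K) in
/-- The grade involution of `Cl`, transported from the abstract Clifford algebra. -/
theorem exists_gradeInvolution (hK : IsNormedDivision K) :
    ∃ s : Cl K' K →ₐ[ℝ] Cl K' K, ∀ P, s (toClL K' K P) = toClL K' K (-P) := by
  let Φ := AlgEquiv.ofBijective (cliffordToCl K' K)
    ⟨cliffordToCl_injective hK, cliffordToCl_surjective⟩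
  have hΦ : ∀ P : V4 K' K, Φ (CliffordAlgebra.ι (V4form K' K) P) = toClL K' K P := cliffordToCl_ι
  refine ⟨(Φ.toAlgHom.comp CliffordAlgebra.involute).comp Φ.symm.toAlgHom, fun P => ?_⟩
  change Φ (CliffordAlgebra.involute (Φ.symm (toClL K' K P))) = _
  rw [← hΦ, AlgEquiv.symm_apply_apply, CliffordAlgebra.involute_ι, ← map_neg, hΦ]

end Assembly

theorem theorem2 {K' K : Type*}
    [NonAssocRing K'] [Module ℝ K'] [CompositionAlgebra K']
    [NonAssocRing K] [Module ℝ K] [CompositionAlgebra K]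
    (hK' : IsSplit K') (hK : IsNormedDivision K) :
    -- `V₄` has signature `(κ + κ'₊, κ'₋)`
    Nonempty ((stdForm (Module.finrank ℝ K + kappaPos K') (kappaNeg K')).IsometryEquiv
      (V4form K' K)) ∧
    -- the algebra generated by `V₄` is the Clifford algebra of `V₄`
    (∃ Φ : CliffordAlgebra (V4form K' K) ≃ₐ[ℝ] Cl K' K,
      ∀ P : V4 K' K, Φ (CliffordAlgebra.ι (V4form K' K) P) = toCl P) ∧
    -- unit vectors: matrix inverses, and independence of `P Q P⁻¹` of the bracketing
    (∀ P : V4 K' K, IsUnitVec P →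
      (P : Mat4 K' K) * vinv P = 1 ∧ vinv P * (P : Mat4 K' K) = 1 ∧
      (∀ Y : Mat4 K' K, (P : Mat4 K' K) * Y = 1 → Y * (P : Mat4 K' K) = 1 → Y = vinv P) ∧
      ∀ Q : V4 K' K, ((P : Mat4 K' K) * Q) * vinv P = (P : Mat4 K' K) * (Q * vinv P)) ∧
    -- `Pin(V₄)` consists of the products of unit vectors
    (∀ P : V4 K' K, IsUnitVec P →
      ∃ g : Pin K' K, ((g : (Cl K' K)ˣ) : Cl K' K) = toCl P) ∧
    (∀ g : Pin K' K, ∃ l : List (V4 K' K), (∀ P ∈ l, IsUnitVec P) ∧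
      ((g : (Cl K' K)ˣ) : Cl K' K) = (l.map toCl).prod) ∧
    -- the homomorphism `R : Pin(V₄) → O(V₄)`
    ∃ R : Pin K' K →* orthogonalGrp (V4form K' K),
      Function.Surjective R ∧
      -- on a unit vector `P` it is the reflection along `P`, given by Clifford multiplication
      -- and by matrix multiplication
      (∀ (P : V4 K' K) (g : Pin K' K), IsUnitVec P →
        ((g : (Cl K' K)ˣ) : Cl K' K) = toCl P →
        (R g : V4 K' K ≃ₗ[ℝ] V4 K' K) P = -P ∧
        (∀ Q : V4 K' K, QuadraticMap.polar (V4form K' K) P Q = 0 →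
          (R g : V4 K' K ≃ₗ[ℝ] V4 K' K) Q = Q) ∧
        ∀ Q : V4 K' K,
          toCl ((R g : V4 K' K ≃ₗ[ℝ] V4 K' K) Q) =
            -(toCl P * toCl Q * ((g : (Cl K' K)ˣ)⁻¹ : (Cl K' K)ˣ)) ∧
          (((R g : V4 K' K ≃ₗ[ℝ] V4 K' K) Q : V4 K' K) : Mat4 K' K) =
            -(((P : Mat4 K' K) * Q) * vinv P)) ∧
      -- on a product `P₁ · ⋯ · Pₙ` of unit vectors it is given by nested matrix products
      (∀ (l : List (V4 K' K)) (g : Pin K' K), (∀ P ∈ l, IsUnitVec P) →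
        ((g : (Cl K' K)ˣ) : Cl K' K) = (l.map toCl).prod →
        ∀ Q : V4 K' K, (((R g : V4 K' K ≃ₗ[ℝ] V4 K' K) Q : V4 K' K) : Mat4 K' K) =
          (-1 : ℝ) ^ l.length • nestedConj l (Q : Mat4 K' K)) ∧
      -- it restricts to a homomorphism of `Spin(V₄)` onto `SO(V₄)`
      (∃ S : Spin K' K →* specialOrthogonalGrp (V4form K' K),
        Function.Surjective S ∧
        ∀ g : Spin K' K, (S g : V4 K' K ≃ₗ[ℝ] V4 K' K) = R (g : Pin K' K)) ∧
      -- the second-order elements `P₁ · P₂` generate a faithful action of `SO(κ + κ'₊, κ'₋)`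
      -- on `V₄`, the standard one up to the identification of `ℝ^(κ + κ'₊, κ'₋)` with `V₄`
      ∀ e : (stdForm (Module.finrank ℝ K + kappaPos K') (kappaNeg K')).IsometryEquiv
          (V4form K' K),
        ∃ α : specialOrthogonalGrp (stdForm (Module.finrank ℝ K + kappaPos K') (kappaNeg K')) →*
            (V4 K' K ≃ₗ[ℝ] V4 K' K),
          Function.Injective α ∧
          (∀ h x, α h (e x) = e ((h : (Fin (Module.finrank ℝ K + kappaPos K') ⊕
            Fin (kappaNeg K') → ℝ) ≃ₗ[ℝ] _) x)) ∧
          α.range = Subgroup.closure {f | ∃ (g : Pin K' K) (P₁ P₂ : V4 K' K),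
            IsUnitVec P₁ ∧ IsUnitVec P₂ ∧
            ((g : (Cl K' K)ˣ) : Cl K' K) = toCl P₁ * toCl P₂ ∧
            f = (R g : V4 K' K ≃ₗ[ℝ] V4 K' K)} := by
  have hQ : Subgroup.closure (unitReflections (V4form K' K)) = orthogonalGrp (V4form K' K) := by
    obtain ⟨e⟩ := nonempty_isometryEquiv_V4 (K' := K') hK
    obtain ⟨b, hb, hbb⟩ := exists_orthogonal_basis_of_stdForm e
    exact closure_unitReflections (V4form K' K) b hb hbb
  have hj := toCl_mul_self K' K
  have hinj := toCl_injective K' K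
  refine (exists_gradeInvolution K' K hK).elim fun s hs => ?_
  refine (exists_twistedAdjoint (A := Cl K' K) (Q := V4form K' K) (j := toClL K' K) (s := s)
    hj hinj hs).elim fun R hR => ?_
  have hsurj := twistedAdjoint_surjective (A := Cl K' K) (Q := V4form K' K) (j := toClL K' K)
    (s := s) (R := R) hj hinj hs hR hQ
  have hspin := exists_spinOf_hom (A := Cl K' K) (Q := V4form K' K) (j := toClL K' K)
    (s := s) (R := R) hj hinj hs hR hQ
  have hpairs := closure_twistedAdjoint_pairs (A := Cl K' K) (Q := V4form K' K) (j := toClL K' K)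
    (s := s) (R := R) hj hinj hs hR hQ
  refine ⟨nonempty_isometryEquiv_V4 hK, ⟨AlgEquiv.ofBijective (cliffordToCl K' K)
    ⟨cliffordToCl_injective hK, cliffordToCl_surjective⟩, cliffordToCl_ι⟩,
    fun P hP => ⟨mul_vinv hP, vinv_mul hP, fun Y hY _ => eq_vinv_of_mul_eq_one hP hY,
      mul_mul_vinv_assoc P⟩,
    fun P hP => exists_unit_eq (A := Cl K' K) (Q := V4form K' K) (j := toClL K' K) hj hP,
    fun g => exists_list_of_pinOf (A := Cl K' K) (Q := V4form K' K) (j := toClL K' K) hj g, R,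
    hsurj, fun P g hP hg => ?_, fun l g hl hg Q => ?_, hspin, fun e => ?_⟩
  · have h0 := ne_zero_of_eq_one_or hP
    have hRg := twistedAdjoint_of_eq (A := Cl K' K) (Q := V4form K' K) (j := toClL K' K)
      (s := s) (R := R) hj hinj hs hR h0 hg
    have hconj := mul_mul_inv_eq_neg_orthoReflection (A := Cl K' K) (Q := V4form K' K)
      (j := toClL K' K) hj h0 hg
    have hRQ := fun Q => LinearEquiv.congr_fun hRg Q
    refine ⟨(hRQ P).trans (orthoReflection_self _ _ _),
      fun Q hPQ => (hRQ Q).trans (orthoReflection_of_polar_eq_zero _ _ _ hPQ), fun Q => ⟨?_,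
        (congrArg Subtype.val (hRQ Q)).trans (coe_orthoReflection h0 Q)⟩⟩
    refine (congrArg (toClL K' K) (hRQ Q)).trans (Eq.trans ?_ (congrArg Neg.neg (hconj Q)).symm)
    exact toCl_eq_neg_toCl_neg _
  · have hRg := twistedAdjoint_list_apply (A := Cl K' K) (Q := V4form K' K) (j := toClL K' K)
      (s := s) (R := R) hj hinj hs hR l hl g hg Q
    exact (congrArg Subtype.val hRg).trans (coe_foldr_eq_nestedConj l hl Q)
  · obtain ⟨α, hα, hαe, hrange⟩ := exists_specialOrthogonalGrp_hom e
    exact ⟨α, hα, hαe, hrange.trans hpairs.symm⟩
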